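/- **Fast algorithm.** Let $T\ge 2$ and $r>T^2$ be integers. Fix a bilinear algorithm for multiplying two $T\times T$ matrices with $r$ multiplications $M_1,\dots,M_r$: each $M_l$ is the product of a nonempty $\{-1,1\}$-weighted sum of entries of $A$ and a nonempty $\{-1,1\}$-weighted sum of entries of $B$, and each entry of $AB$ is a $\{-1,1\}$-weighted sum of some of the $M_l$, the resulting identities being valid for all $T\times T$ integer matrices $A,B$ (equivalently, over every ring, so that they may be applied to blocks). Let $a_l$ and $b_l$ be the numbers of distinct entries of $A$ and of $B$ that appear in $M_l$, let $c_l$ be the number of entries of $AB$ in whose expressions $M_l$ appears, and let $s=\max\{\sum_l a_l,\ \sum_l b_l,\ \sum_l c_l\}$ be the sparsity of the algorithm. Put $$\omega=\log_T r,\qquad \alpha=\frac{r}{s},\qquad \beta=\frac{s}{T^2},\qquad \gamma=\log_\beta(1/\alpha),\qquad c=\frac{\log_T(\alpha\beta)}{1-\gamma}.$$ **Circuits.** A threshold circuit is a finite acyclic network of gates of unbounded fan-in over Boolean inputs; a gate with inputs $y_1,\dots,y_n$ outputs $1$ if and only if $\sum_i w_iy_i\ge t$, where the integer weights $w_i$ and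 the integer threshold $t$ are constants of the gate. The outputs are read off at designated nodes. Its size is the number of gates, and its depth is the largest number of gates on a directed path. An integer $x$ is given as $x=x^+-x^-$ with nonnegative integers $x^\pm$ written in binary, and it has $b$ bits if $x^+$ and $x^-$ have $b$ bits each. A circuit computes the product of two $N\times N$ integer matrices with $b$-bit entries if, for all values of the input bits, its outputs are the bits of the entries of $AB$ in such a representation, with some number $m$ of bits. **Theorem.** We have $c>0$ and $0\le\gamma<1$. Moreover, for every constant $\kappa$ there are constants $K$ and $e\in\mathbb{N}$ (depending only on the algorithm and on $\kappa$) such that for every $N=T^l$ with $l\ge 1$, every $b\le\kappa\log N$ and every integer $d\ge 1$ there is a threshold circuit of depth at most $4d+1$ that computes the product of two $N\times N$ integer matrices with $b$-bit entries and has at most $$K\,(\log N)^{e}\cdot d\,N^{\omega+c\gamma^d}$$ gates, that is, $\widetilde O\big(d\,N^{\omega+c\gamma^d}\big)$ gates, uniformly in $d$. -/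

import Mathlib

/-- A bilinear algorithm that multiplies two `T × T` matrices with `r` multiplications
`M_1, …, M_r`.  Each `M_l` is the product of a nonempty `{-1,1}`-weighted sum of entries of `A`
and a nonempty `{-1,1}`-weighted sum of entries of `B`; each entry of `A * B` is a
`{-1,1}`-weighted sum of the `M_l`.  A coefficient `0` means that the term does not appear.
Both sides of `correct` are bilinear in `(A, B)`, with the factors from `A` on the left, so its
validity over `ℤ` is the same as its validity over every ring, in particular for blocks. -/
structure MatMulAlgorithm (T r : ℕ) where
  a : Fin r → Fin T → Fin T → SignType
  b : Fin r → Fin T → Fin T → SignType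
  c : Fin r → Fin T → Fin T → SignType
  a_nonempty : ∀ l, ∃ p q, a l p q ≠ 0
  b_nonempty : ∀ l, ∃ p q, b l p q ≠ 0
  correct : ∀ (A B : Matrix (Fin T) (Fin T) ℤ) (i j : Fin T),
    (A * B) i j = ∑ l, (c l i j : ℤ) *
      ((∑ p, ∑ q, (a l p q : ℤ) * A p q) * (∑ p, ∑ q, (b l p q : ℤ) * B p q))

namespace MatMulAlgorithm

variable {T r : ℕ} (M : MatMulAlgorithm T r)

/-- Total number of appearances of entries of `A` in the expressions `M_1, …, M_r`. -/
def sparsityA : ℕ := ∑ l, (Finset.univ.filter fun p : Fin T × Fin T => M.a l p.1 p.2 ≠ 0).card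

/-- Total number of appearances of entries of `B` in the expressions `M_1, …, M_r`. -/
def sparsityB : ℕ := ∑ l, (Finset.univ.filter fun p : Fin T × Fin T => M.b l p.1 p.2 ≠ 0).card

/-- Total number of appearances of `M_1, …, M_r` in the expressions for the entries of `A * B`. -/
def sparsityC : ℕ := ∑ l, (Finset.univ.filter fun p : Fin T × Fin T => M.c l p.1 p.2 ≠ 0).card

/-- The sparsity `s` of the algorithm. -/
def sparsity : ℕ := max M.sparsityA (max M.sparsityB M.sparsityC)

/-- `ω = log_T r`. -/
noncomputable def omega (_M : MatMulAlgorithm T r) : ℝ := Real.logb T r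

/-- `α = r / s`. -/
noncomputable def alpha : ℝ := (r : ℝ) / M.sparsity

/-- `β = s / T ^ 2`. -/
noncomputable def beta : ℝ := (M.sparsity : ℝ) / (T : ℝ) ^ 2

/-- `γ = log_β (1 / α)`. -/
noncomputable def gamma : ℝ := Real.logb M.beta (1 / M.alpha)

/-- `c = log_T (α β) / (1 - γ)`. -/
noncomputable def cConst : ℝ := Real.logb T (M.alpha * M.beta) / (1 - M.gamma)

end MatMulAlgorithm

/-- A threshold circuit with Boolean inputs indexed by `ι` and outputs indexed by `o`: a finite
acyclic network of gates with integer weights and thresholds, of unbounded fan-in.  There is a wire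
from a node (an input or a gate) into the gate `g` where the weight is nonzero.  Each output is read
off at a node. -/
structure ThresholdCircuit (ι o : Type) where
  Gate : Type
  [fintypeGate : Fintype Gate]
  weight : Gate → ι ⊕ Gate → ℤ
  threshold : Gate → ℤ
  acyclic : WellFounded fun h g : Gate => weight g (Sum.inr h) ≠ 0
  out : o → ι ⊕ Gate

namespace ThresholdCircuit

attribute [instance] ThresholdCircuit.fintypeGate

variable {ι o : Type}

/-- The number of gates. -/
def size (C : ThresholdCircuit ι o) : ℕ := Fintype.card C.Gate

/-- The value of a gate on the input `x`: it fires if and only if the weighted sum of the values of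
the nodes wired to it is at least its threshold. -/
noncomputable def gateVal [Fintype ι] (C : ThresholdCircuit ι o) (x : ι → Bool) : C.Gate → Bool :=
  C.acyclic.fix fun g val =>
    decide (C.threshold g ≤
      (∑ i, C.weight g (Sum.inl i) * (if x i then 1 else 0)) +
      ∑ h, if hw : C.weight g (Sum.inr h) ≠ 0 then
        C.weight g (Sum.inr h) * (if val h hw then 1 else 0) else 0)

/-- The vector of output bits on the input `x`. -/
noncomputable def eval [Fintype ι] (C : ThresholdCircuit ι o) (x : ι → Bool) : o → Bool :=
  fun k => Sum.elim x (C.gateVal x) (C.out k)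

/-- The depth of a gate: the largest number of gates on a directed path that ends in it. -/
noncomputable def gateDepth (C : ThresholdCircuit ι o) : C.Gate → ℕ :=
  C.acyclic.fix fun g dep =>
    (Finset.univ.sup fun h => if hw : C.weight g (Sum.inr h) ≠ 0 then dep h hw else 0) + 1

/-- The depth of the circuit: the largest depth of a gate, hence at least the length of every
directed path from an input to an output. -/
noncomputable def depth (C : ThresholdCircuit ι o) : ℕ := Finset.univ.sup C.gateDepth

theorem gateVal_eq_true_iff [Fintype ι] (C : ThresholdCircuit ι o) (x : ι → Bool) (g : C.Gate) :
    C.gateVal x g = true ↔ C.threshold g ≤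
      (∑ i, C.weight g (Sum.inl i) * (if x i then 1 else 0)) +
      ∑ h, C.weight g (Sum.inr h) * (if C.gateVal x h then 1 else 0) := by
  conv_lhs => rw [gateVal, WellFounded.fix_eq]
  rw [decide_eq_true_iff]
  have key : ∀ h, (if _hw : C.weight g (Sum.inr h) ≠ 0 then
      C.weight g (Sum.inr h) * (if C.gateVal x h then 1 else 0) else 0) =
      C.weight g (Sum.inr h) * (if C.gateVal x h then 1 else 0) := by
    intro h
    by_cases hw : C.weight g (Sum.inr h) = 0 <;> simp [hw]
  rw [← Finset.sum_congr rfl fun h _ => key h]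
  rfl

theorem gateDepth_eq (C : ThresholdCircuit ι o) (g : C.Gate) :
    C.gateDepth g =
      (Finset.univ.sup fun h => if C.weight g (Sum.inr h) ≠ 0 then C.gateDepth h else 0) + 1 := by
  conv_lhs => rw [gateDepth, WellFounded.fix_eq]
  rfl

end ThresholdCircuit

/-- Index set for the bits of an `N × N` integer matrix: row, column, part, position.  Every entry
is given as `x = x⁺ - x⁻`, where `x⁺` (part `true`) and `x⁻` (part `false`) are nonnegative integers
written in binary with `b` bits each, the bit at position `k` having weight `2 ^ k`. -/
abbrev MatrixBits (N b : ℕ) : Type := Fin N × Fin N × Bool × Fin b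

/-- The integer matrix that an assignment of bits represents. -/
def decodeMatrix {N b : ℕ} (x : MatrixBits N b → Bool) : Matrix (Fin N) (Fin N) ℤ :=
  fun i j =>
    (∑ k : Fin b, 2 ^ (k : ℕ) * (if x (i, j, true, k) then 1 else 0)) -
    (∑ k : Fin b, 2 ^ (k : ℕ) * (if x (i, j, false, k) then 1 else 0))

/-- The circuit reads two `N × N` matrices with `b`-bit entries and outputs the bits of their
product, for all values of the input bits. -/
def ThresholdCircuit.ComputesMatMul {N b m : ℕ}
    (C : ThresholdCircuit (MatrixBits N b ⊕ MatrixBits N b) (MatrixBits N m)) : Prop :=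
  ∀ x y : MatrixBits N b → Bool,
    decodeMatrix (C.eval (Sum.elim x y)) = decodeMatrix x * decodeMatrix y

/-! Unroll the recursion for N = T^L. A level h of the recursion tree holds r^h matrices with
(T^2)^(L-h) entries each; an entry is indexed by L coordinates, of which the first h are indices of
multiplications and the others are pairs of indices below T. Passing from level h to level h' ≥ h is
linear: its matrix is a Kronecker product over the coordinates, with the coefficient matrix of the
algorithm in the h'-h coordinates being processed and the identity elsewhere. Since the number of
nonzero entries is multiplicative, it is at most r^h s^(h'-h) (T^2)^(L-h') = α^h β^h' T^(2L) =
β^(h'-γh) T^(2L) for each factor, and the same bound holds for the transition back up.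

Such a map with coefficients 0, 1, -1 costs depth two and, up to powers of log N, as many gates as
it has nonzero entries (`exists_linear_circuit`). Indeed bit k of a sum is the parity of the
quotient by 2^k, and after reducing the weights mod 2^(k+1) this quotient is at most twice the
number of terms, so one layer can compare it with every possible value (`exists_sum_circuit`). Only
d+1 levels 0 = h_0 ≤ ... ≤ h_d = L are computed: d steps down for A and B together, one layer of bit
products at the leaves, d steps up. The depth is 2d + 1 + 2d.

It remains to keep h_{i+1} - γ h_i small for all i at once. With h_i = ⌈L(1-γ^i)/(1-γ^d)⌉ it would
be constant in i but for the rounding, and it is at most L(1-γ) + Lγ^d + 1 (`level_succ_le`). As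
β^(1-γ) = αβ = r/T^2 and c = log_T β, a step costs at most β N^(ω+cγ^d) terms (`step_cost_le`). -/

namespace ThresholdCircuit

/-! ### Layers, wires and composition of circuits -/

variable {ι o o' : Type}

/-- A single layer of gates that all read the inputs. -/
def layer {g : Type} [Fintype g] (w : g → ι → ℤ) (t : g → ℤ) : ThresholdCircuit ι g where
  Gate := g
  weight k := Sum.elim (w k) fun _ => 0
  threshold := t
  acyclic := ⟨fun _ => ⟨_, fun _ h => absurd rfl h⟩⟩
  out := Sum.inr

theorem layer_eval_eq_true_iff [Fintype ι] {g : Type} [Fintype g] (w : g → ι → ℤ) (t : g → ℤ)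
    (x : ι → Bool) (k : g) :
    (layer w t).eval x k = true ↔ t k ≤ ∑ i, w k i * (if x i then 1 else 0) := by
  have h := gateVal_eq_true_iff (layer w t) x k
  simpa [eval, layer] using h

theorem layer_depth_le {g : Type} [Fintype g] (w : g → ι → ℤ) (t : g → ℤ) :
    (layer w t).depth ≤ 1 := by
  refine Finset.sup_le fun k _ => ?_
  rw [gateDepth_eq]
  simp [layer]

theorem layer_size {g : Type} [Fintype g] (w : g → ι → ℤ) (t : g → ℤ) :
    (layer w t).size = Fintype.card g := rfl

/-- A circuit without gates. -/
def wires (f : o → ι) : ThresholdCircuit ι o where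
  Gate := Empty
  weight k := k.elim
  threshold k := k.elim
  acyclic := ⟨fun k => k.elim⟩
  out := fun k => Sum.inl (f k)

theorem wires_eval [Fintype ι] (f : o → ι) (x : ι → Bool) (k : o) :
    (wires f).eval x k = x (f k) := rfl

theorem wires_depth (f : o → ι) : (wires f).depth = 0 := rfl

theorem wires_size (f : o → ι) : (wires f).size = 0 := rfl

/-- The nodes of a circuit as nodes of a composite circuit. -/
def liftNode {G : Type} (H : Type) : ι ⊕ G → ι ⊕ (G ⊕ H) :=
  Sum.map id Sum.inl

open Classical in
/-- The composition of two circuits: the second one reads the outputs of the first one. -/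
noncomputable def comp [Fintype o] (C : ThresholdCircuit ι o) (D : ThresholdCircuit o o') :
    ThresholdCircuit ι o' where
  Gate := C.Gate ⊕ D.Gate
  weight := Sum.elim
    (fun g => Sum.elim (fun i => C.weight g (Sum.inl i))
      (Sum.elim (fun h => C.weight g (Sum.inr h)) fun _ => 0))
    -- Several outputs may be read off at one node; the weights of the merged wires add up.
    (fun g => Sum.elim (fun i => ∑ k, if C.out k = Sum.inl i then D.weight g (Sum.inl k) else 0)
      (Sum.elim (fun h => ∑ k, if C.out k = Sum.inr h then D.weight g (Sum.inl k) else 0)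
        fun h => D.weight g (Sum.inr h)))
  threshold := Sum.elim C.threshold D.threshold
  acyclic := by
    refine Subrelation.wf ?_ (Sum.lex_wf C.acyclic D.acyclic)
    rintro (h | h) (g | g) hw
    · exact Sum.Lex.inl hw
    · exact Sum.Lex.sep _ _
    · exact absurd rfl hw
    · exact Sum.Lex.inr hw
  out k := Sum.elim (fun j => liftNode D.Gate (C.out j)) (fun h => Sum.inr (Sum.inr h)) (D.out k)

variable [Fintype o] (C : ThresholdCircuit ι o) (D : ThresholdCircuit o o')

theorem comp_size : (C.comp D).size = C.size + D.size :=
  Fintype.card_sum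

theorem comp_gateVal_inl [Fintype ι] (x : ι → Bool) (g : C.Gate) :
    (C.comp D).gateVal x (Sum.inl g) = C.gateVal x g := by
  induction g using C.acyclic.induction with
  | _ g ih =>
    refine Bool.eq_iff_iff.2 ((gateVal_eq_true_iff (C.comp D) x (Sum.inl g)).trans
      (Iff.trans ?_ (gateVal_eq_true_iff C x g).symm))
    refine iff_of_eq (congrArg₂ _ rfl (congrArg₂ _ rfl ?_))
    refine (Fintype.sum_sum_type _).trans ?_
    rw [add_eq_left.2]
    · refine Finset.sum_congr rfl fun h _ => ?_
      -- The induction hypothesis covers only gates wired to `g`; the others contribute zero.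
      by_cases hw : C.weight g (Sum.inr h) = 0
      · change C.weight g (Sum.inr h) * _ = _
        rw [hw, zero_mul, zero_mul]
      · rw [ih h hw]; rfl
    · exact Finset.sum_eq_zero fun h _ => zero_mul _

theorem comp_gateVal_inr [Fintype ι] (x : ι → Bool) (g : D.Gate) :
    (C.comp D).gateVal x (Sum.inr g) = D.gateVal (C.eval x) g := by
  classical
  induction g using D.acyclic.induction with
  | _ g ih =>
    refine Bool.eq_iff_iff.2 ((gateVal_eq_true_iff (C.comp D) x (Sum.inr g)).trans
      (Iff.trans ?_ (gateVal_eq_true_iff D (C.eval x) g).symm))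
    refine iff_of_eq (congrArg₂ _ rfl ?_)
    -- Each output sits at exactly one node, so its value is a sum over all nodes; interchanging
    -- sums then yields the merged weights.
    have key : ∀ k : o, (if C.eval x k then (1 : ℤ) else 0) =
        (∑ i, if C.out k = Sum.inl i then (if x i then 1 else 0) else 0) +
        ∑ h, if C.out k = Sum.inr h then (if C.gateVal x h then 1 else 0) else 0 := by
      intro k
      rcases hk : C.out k with i | h <;> simp [eval, hk]
    have e1 : ∀ i, (C.comp D).weight (Sum.inr g) (Sum.inl i) =
      ∑ k, if C.out k = Sum.inl i then D.weight g (Sum.inl k) else 0 := fun i => rfl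
    have e2 : ∀ h, (C.comp D).weight (Sum.inr g) (Sum.inr (Sum.inl h)) =
      ∑ k, if C.out k = Sum.inr h then D.weight g (Sum.inl k) else 0 := fun i => rfl
    have e3 : ∀ h, (C.comp D).weight (Sum.inr g) (Sum.inr (Sum.inr h)) =
      D.weight g (Sum.inr h) := fun i => rfl
    have e4 : ∑ h : (C.comp D).Gate, (C.comp D).weight (Sum.inr g) (Sum.inr h) *
        (if (C.comp D).gateVal x h then 1 else 0) =
        ∑ h, (C.comp D).weight (Sum.inr g) (Sum.inr (Sum.inl h)) *
          (if (C.comp D).gateVal x (Sum.inl h) then 1 else 0) +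
        ∑ h, (C.comp D).weight (Sum.inr g) (Sum.inr (Sum.inr h)) *
          (if (C.comp D).gateVal x (Sum.inr h) then 1 else 0) := Fintype.sum_sum_type _
    have e5 : ∑ h, D.weight g (Sum.inr h) *
          (if (C.comp D).gateVal x (Sum.inr h) then 1 else 0) =
        ∑ h, D.weight g (Sum.inr h) * (if D.gateVal (C.eval x) h then 1 else 0) := by
      refine Finset.sum_congr rfl fun h _ => ?_
      by_cases hw : D.weight g (Sum.inr h) = 0
      · rw [hw, zero_mul, zero_mul]
      · rw [ih h hw]
    rw [e4]
    simp only [e1, e2, e3, e5, comp_gateVal_inl, ← add_assoc]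
    congr 1
    simp only [key, mul_add, Finset.sum_add_distrib, Finset.sum_mul, Finset.mul_sum]
    congr 1 <;>
    · rw [Finset.sum_comm]
      refine Finset.sum_congr rfl fun k _ => Finset.sum_congr rfl fun i _ => ?_
      split_ifs <;> simp

theorem comp_eval [Fintype ι] (x : ι → Bool) : (C.comp D).eval x = D.eval (C.eval x) := by
  funext k
  have h1 : (C.comp D).out k =
    Sum.elim (fun j => liftNode D.Gate (C.out j)) (fun h => Sum.inr (Sum.inr h)) (D.out k) := rfl
  unfold eval
  rw [h1]
  rcases hk : D.out k with j | h
  · simp only [Sum.elim_inl]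
    rcases hj : C.out j with i | h
    · rfl
    · exact comp_gateVal_inl C D x h
  · exact comp_gateVal_inr C D x h

theorem comp_gateDepth_inl (g : C.Gate) :
    (C.comp D).gateDepth (Sum.inl g) ≤ C.gateDepth g := by
  induction g using C.acyclic.induction with
  | _ g ih =>
    refine (gateDepth_eq (C.comp D) (Sum.inl g)).le.trans ?_
    rw [gateDepth_eq]
    refine Nat.succ_le_succ (Finset.sup_le ?_)
    rintro (h | h) -
    · by_cases hw : C.weight g (Sum.inr h) = 0
      · exact (if_neg (not_not.2 hw)).le.trans (Nat.zero_le _)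
      · refine (if_pos hw).le.trans ((ih h hw).trans ?_)
        exact (if_pos hw).ge.trans (Finset.le_sup
          (f := fun h => if C.weight g (Sum.inr h) ≠ 0 then C.gateDepth h else 0)
          (Finset.mem_univ h))
    · exact (if_neg (not_not.2 rfl)).le.trans (Nat.zero_le _)

theorem comp_gateDepth_inr (g : D.Gate) :
    (C.comp D).gateDepth (Sum.inr g) ≤ C.depth + D.gateDepth g := by
  induction g using D.acyclic.induction with
  | _ g ih =>
    refine (gateDepth_eq (C.comp D) (Sum.inr g)).le.trans ?_
    rw [gateDepth_eq, ← add_assoc]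
    refine Nat.succ_le_succ (Finset.sup_le ?_)
    rintro (h | h) -
    · split_ifs
      · refine (comp_gateDepth_inl C D h).trans (le_trans ?_ (Nat.le_add_right _ _))
        exact Finset.le_sup (f := C.gateDepth) (Finset.mem_univ h)
      · exact Nat.zero_le _
    · by_cases hw : D.weight g (Sum.inr h) = 0
      · exact (if_neg (not_not.2 hw)).le.trans (Nat.zero_le _)
      · refine (if_pos hw).le.trans ((ih h hw).trans (Nat.add_le_add_left ?_ _))
        exact (if_pos hw).ge.trans (Finset.le_sup
          (f := fun h => if D.weight g (Sum.inr h) ≠ 0 then D.gateDepth h else 0)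
          (Finset.mem_univ h))

theorem comp_depth_le : (C.comp D).depth ≤ C.depth + D.depth := by
  refine Finset.sup_le ?_
  rintro (g | g) -
  · refine (comp_gateDepth_inl C D g).trans (le_trans ?_ (Nat.le_add_right _ _))
    exact Finset.le_sup (f := C.gateDepth) (Finset.mem_univ g)
  · refine (comp_gateDepth_inr C D g).trans (Nat.add_le_add_left ?_ _)
    exact Finset.le_sup (f := D.gateDepth) (Finset.mem_univ g)

end ThresholdCircuit

/-! ### Bits of weighted sums in depth two -/

open ThresholdCircuit

theorem sum_range_neg_one_pow (q : ℕ) :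
    ∑ t ∈ Finset.range q, (-1 : ℤ) ^ t = ((q % 2 : ℕ) : ℤ) := by
  induction q with
  | zero => simp
  | succ q ih =>
    rw [Finset.sum_range_succ, ih]
    rcases Nat.even_or_odd q with h | h
    · rw [h.neg_one_pow]; have := Nat.even_iff.1 h; omega
    · rw [h.neg_one_pow]; have := Nat.odd_iff.1 h; omega

/-- Lets a single threshold gate read the parity of `q` from the comparisons t < q. -/
theorem sum_fin_neg_one_pow_lt (m q : ℕ) (h : q ≤ m) :
    ∑ t : Fin m, (-1 : ℤ) ^ (t : ℕ) * (if (t : ℕ) < q then 1 else 0) = ((q % 2 : ℕ) : ℤ) := by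
  rw [← sum_range_neg_one_pow,
    Fin.sum_univ_eq_sum_range (fun t => (-1 : ℤ) ^ t * if t < q then 1 else 0) m]
  simp only [mul_ite, mul_one, mul_zero]
  rw [← Finset.sum_filter]
  congr 1
  ext t
  simp only [Finset.mem_filter, Finset.mem_range]
  omega

theorem Nat.testBit_eq_mod_two_pow_div (n k : ℕ) :
    n.testBit k = decide (n % 2 ^ (k + 1) / 2 ^ k = 1) := by
  rw [Nat.testBit_eq_decide_div_mod_eq, pow_succ, Nat.mod_mul_right_div_self]

theorem sum_two_pow_mul_testBit (n W : ℕ) :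
    ∑ k : Fin W, 2 ^ (k : ℕ) * (n.testBit k).toNat = n % 2 ^ W := by
  rw [Fin.sum_univ_eq_sum_range (fun k => 2 ^ k * (n.testBit k).toNat) W]
  induction W with
  | zero => simp [Nat.mod_one]
  | succ W ih =>
    rw [Finset.sum_range_succ, ih, pow_succ, Nat.mod_mul, Nat.testBit_eq_decide_div_mod_eq]
    rcases Nat.mod_two_eq_zero_or_one (n / 2 ^ W) with h | h <;> simp [h]

/-- All the bits of a family of sums of weighted Boolean variables in depth two. -/
theorem exists_sum_circuit {J R : Type} [Fintype J] [Fintype R] (u : R → J → ℕ) (n : R → ℕ)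
    (hn : ∀ i, (Finset.univ.filter fun j => u i j ≠ 0).card ≤ n i) (W : ℕ) :
    ∃ C : ThresholdCircuit J (R × Fin W), C.depth ≤ 2 ∧
      C.size = ∑ i, W * (2 * n i) + Fintype.card R * W ∧
      ∀ z i k, C.eval z (i, k) = (∑ j, u i j * (z j).toNat).testBit k := by
  classical
  let L₁ : ThresholdCircuit J (Σ i : R, Fin W × Fin (2 * n i)) :=
    layer (fun g j => ((u g.1 j % 2 ^ ((g.2.1 : ℕ) + 1) : ℕ) : ℤ))
      (fun g => ((((g.2.2 : ℕ) + 1) * 2 ^ (g.2.1 : ℕ) : ℕ) : ℤ))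
  let L₂ : ThresholdCircuit (Σ i : R, Fin W × Fin (2 * n i)) (R × Fin W) :=
    layer (fun g h => if (h.1, h.2.1) = g then (-1) ^ (h.2.2 : ℕ) else 0) (fun _ => 1)
  refine ⟨L₁.comp L₂, (comp_depth_le _ _).trans
    (add_le_add (layer_depth_le _ _) (layer_depth_le _ _)), ?_, ?_⟩
  · rw [comp_size]
    simp only [L₁, L₂, layer_size, Fintype.card_sigma, Fintype.card_prod, Fintype.card_fin]
  intro z i k
  set S := ∑ j, u i j * (z j).toNat with hS
  set S' := ∑ j, (u i j % 2 ^ ((k : ℕ) + 1)) * (z j).toNat with hS'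
  -- Bit k depends only on the residue mod 2^(k+1), so the weights may be reduced; this bounds the
  -- quotient independently of their size.
  have hmod : S % 2 ^ ((k : ℕ) + 1) = S' % 2 ^ ((k : ℕ) + 1) := by
    rw [hS, hS']
    refine Nat.ModEq.sum fun j _ => ?_
    exact (Nat.mod_modEq _ _).symm.mul_right _
  have hq : S' / 2 ^ (k : ℕ) ≤ 2 * n i := by
    refine Nat.div_le_of_le_mul ?_
    have h1 : S' ≤ ∑ j, if u i j ≠ 0 then 2 ^ ((k : ℕ) + 1) else 0 := by
      refine Finset.sum_le_sum fun j _ => ?_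
      split_ifs with h
      · refine (Nat.mul_le_mul (Nat.mod_lt _ (by positivity)).le (Bool.toNat_le _)).trans ?_
        simp
      · simp [not_not.1 h]
    rw [← Finset.sum_filter, Finset.sum_const, smul_eq_mul] at h1
    refine h1.trans ((Nat.mul_le_mul_right _ (hn i)).trans (le_of_eq ?_))
    ring
  -- The threshold (t+1)·2^k tests whether the quotient exceeds t.
  have h1 : ∀ t : Fin (2 * n i), L₁.eval z ⟨i, k, t⟩ = decide ((t : ℕ) < S' / 2 ^ (k : ℕ)) := by
    intro t
    rw [Bool.eq_iff_iff, layer_eval_eq_true_iff, decide_eq_true_iff]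
    have : ∑ j, ((u i j % 2 ^ ((k : ℕ) + 1) : ℕ) : ℤ) * (if z j then 1 else 0) = (S' : ℤ) := by
      rw [hS', Nat.cast_sum]
      refine Finset.sum_congr rfl fun j _ => ?_
      cases z j <;> simp
    change ((((t : ℕ) + 1) * 2 ^ (k : ℕ) : ℕ) : ℤ) ≤ _ ↔ _
    rw [this, Nat.cast_le, ← Nat.le_div_iff_mul_le (by positivity), Nat.succ_le_iff]
  rw [comp_eval, Bool.eq_iff_iff, layer_eval_eq_true_iff, Fintype.sum_sigma,
    Finset.sum_eq_single i, Fintype.sum_prod_type, Finset.sum_eq_single k]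
  · have h2 : ∑ t : Fin (2 * n i), (if ((⟨i, k, t⟩ : Σ i : R, Fin W × Fin (2 * n i)).1,
          (⟨i, k, t⟩ : Σ i : R, Fin W × Fin (2 * n i)).2.1) = (i, k) then (-1 : ℤ) ^ (t : ℕ) else 0) *
        (if L₁.eval z ⟨i, k, t⟩ then 1 else 0) = ((S' / 2 ^ (k : ℕ) % 2 : ℕ) : ℤ) := by
      rw [← sum_fin_neg_one_pow_lt _ _ hq]
      refine Finset.sum_congr rfl fun t _ => ?_
      rw [h1, if_pos rfl]
      simp
    refine (iff_of_eq (congrArg (1 ≤ ·) h2)).trans ?_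
    rw [Nat.testBit_eq_mod_two_pow_div, hmod, ← Nat.testBit_eq_mod_two_pow_div,
      Nat.testBit_eq_decide_div_mod_eq, decide_eq_true_iff]
    omega
  · intro k' _ hk
    refine Finset.sum_eq_zero fun t _ => ?_
    rw [if_neg (fun h => hk (Prod.ext_iff.1 h).2), zero_mul]
  · exact fun h => absurd (Finset.mem_univ _) h
  · intro i' _ hi
    refine Finset.sum_eq_zero fun t _ => ?_
    rw [if_neg (fun h => hi (Prod.ext_iff.1 h).1), zero_mul]
  · exact fun h => absurd (Finset.mem_univ _) h

/-! ### Sparse linear maps and products of signed integers -/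

/-- The indicator of the nonzero signs. -/
def SignType.support (a : SignType) : ℕ := if a = 0 then 0 else 1

/-- The contribution of the part `s'` of a number `x` to the part `s` of `a * x`. -/
def SignType.part (a : SignType) (s s' : Bool) : ℕ :=
  if a = 0 then 0 else if a = 1 then (if s' = s then 1 else 0) else (if s' = s then 0 else 1)

section SignMatrix

variable {X Y : Type} [Fintype X]

/-- The number of nonzero entries in a row of a sign matrix. -/
def rowSupport (w : Y → X → SignType) (y : Y) : ℕ := ∑ x, (w y x).support

/-- The number of nonzero entries of a sign matrix. -/
def matSupport [Fintype Y] (w : Y → X → SignType) : ℕ := ∑ y, rowSupport w y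

end SignMatrix

/-- The part `s` of the number with index `x` in a list of pairs of nonnegative integers that are
given by bits of weights `v`. -/
def partValue {X Q : Type} [Fintype Q] (v : Q → ℕ) (z : X × Bool × Q → Bool) (x : X) (s : Bool) :
    ℕ := ∑ q, v q * (z (x, s, q)).toNat

/-- The bits `z` represent the integers `val`, as differences of nonnegative integers that are at
most `B`. -/
structure Represents {X Q : Type} [Fintype Q] (v : Q → ℕ) (z : X × Bool × Q → Bool) (val : X → ℤ)
    (B : ℕ) : Prop where
  eq : ∀ x, (partValue v z x true : ℤ) - partValue v z x false = val x
  le : ∀ x s, partValue v z x s ≤ B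

/-- The weights of the bits of a binary number. -/
def binWeight (W : ℕ) (k : Fin W) : ℕ := 2 ^ (k : ℕ)

/-- A sparse linear map with coefficients `0, 1, -1` in depth two. -/
theorem exists_linear_circuit {X Y Q : Type} [Fintype X] [Fintype Y] [Fintype Q]
    (w : Y → X → SignType) (v : Q → ℕ) (W : ℕ) :
    ∃ C : ThresholdCircuit (X × Bool × Q) (Y × Bool × Fin W), C.depth ≤ 2 ∧
      C.size ≤ 4 * W * Fintype.card Q * matSupport w + 2 * W * Fintype.card Y ∧
      ∀ z val B m, Represents v z val B → (∀ y, rowSupport w y ≤ m) → m * B < 2 ^ W →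
        Represents (binWeight W) (C.eval z) (fun y => ∑ x, (w y x : ℤ) * val x) (m * B) := by
  classical
  have hv : ∑ q, (if v q = 0 then 0 else 1) ≤ Fintype.card Q :=
    (Finset.sum_le_sum fun q _ => (by split_ifs <;> simp : _ ≤ 1)).trans (by simp)
  -- A sign 1 keeps the two parts of a number and -1 swaps them, so a nonzero coefficient feeds just
  -- one part, at most |Q| bits, into each part of the result.
  obtain ⟨C, hd, hs, hC⟩ := exists_sum_circuit (J := X × Bool × Q) (R := Y × Bool)
    (fun i j => (w i.1 j.1).part i.2 j.2.1 * v j.2.2)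
    (fun i => rowSupport w i.1 * Fintype.card Q) (by
      rintro ⟨y, s⟩
      rw [Finset.card_filter, Fintype.sum_prod_type, rowSupport, Finset.sum_mul]
      refine Finset.sum_le_sum fun x _ => ?_
      rw [Fintype.sum_prod_type, Fintype.sum_bool]
      rcases SignType.trichotomy (w y x) with h | h | h <;> cases s <;>
        simp [h, SignType.part, SignType.support, hv]) W
  refine ⟨C.comp (wires fun p => ((p.1, p.2.1), p.2.2)), ?_, ?_, ?_⟩
  · exact (comp_depth_le _ _).trans (by rw [wires_depth]; exact hd)
  · rw [comp_size, hs, wires_size, Fintype.card_prod, Fintype.card_bool, Fintype.sum_prod_type,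
      matSupport, Finset.mul_sum]
    simp only [Fintype.sum_bool]
    rw [add_zero]
    refine add_le_add (le_of_eq (Finset.sum_congr rfl fun y _ => ?_)) (le_of_eq ?_) <;> ring
  intro z val B m hz hm hB
  have hval : ∀ y s, ∑ j : X × Bool × Q, (w y j.1).part s j.2.1 * v j.2.2 * (z j).toNat =
      ∑ x, ∑ s', (w y x).part s s' * partValue v z x s' := by
    intro y s
    rw [Fintype.sum_prod_type]
    refine Finset.sum_congr rfl fun x _ => ?_
    rw [Fintype.sum_prod_type]
    refine Finset.sum_congr rfl fun s' _ => ?_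
    rw [partValue, Finset.mul_sum]
    exact Finset.sum_congr rfl fun q _ => mul_assoc _ _ _
  have hle : ∀ y s, ∑ x, ∑ s', (w y x).part s s' * partValue v z x s' ≤ m * B := by
    intro y s
    refine le_trans ?_ (Nat.mul_le_mul_right B (hm y))
    rw [rowSupport, Finset.sum_mul]
    refine Finset.sum_le_sum fun x _ => ?_
    rw [Fintype.sum_bool]
    rcases SignType.trichotomy (w y x) with h | h | h <;> cases s <;>
        simp [h, SignType.part, SignType.support, hz.le]
  have hpart : ∀ y s, partValue (binWeight W)
      ((C.comp (wires fun p => ((p.1, p.2.1), p.2.2))).eval z) y s =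
      ∑ x, ∑ s', (w y x).part s s' * partValue v z x s' := by
    intro y s
    simp only [partValue, binWeight, comp_eval, wires_eval, hC]
    rw [sum_two_pow_mul_testBit, hval, Nat.mod_eq_of_lt ((hle y s).trans_lt hB)]
    rfl
  constructor
  · intro y
    rw [hpart, hpart, Nat.cast_sum, Nat.cast_sum, ← Finset.sum_sub_distrib]
    refine Finset.sum_congr rfl fun x _ => ?_
    rw [← hz.eq x, Fintype.sum_bool, Fintype.sum_bool]
    rcases SignType.trichotomy (w y x) with h | h | h <;> simp [h, SignType.part]
  · intro y s
    rw [hpart]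
    exact hle y s

/-- One layer of gates that compute conjunctions of two inputs. -/
theorem exists_and_circuit {ι g : Type} [Fintype ι] [Fintype g] (f₁ f₂ : g → ι) :
    ∃ C : ThresholdCircuit ι g, C.depth ≤ 1 ∧ C.size = Fintype.card g ∧
      ∀ z k, C.eval z k = (z (f₁ k) && z (f₂ k)) := by
  classical
  refine ⟨layer (fun k i => (if i = f₁ k then 1 else 0) + (if i = f₂ k then 1 else 0)) fun _ => 2,
    layer_depth_le _ _, layer_size _ _, fun z k => ?_⟩
  rw [Bool.eq_iff_iff, layer_eval_eq_true_iff]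
  simp only [add_mul, Finset.sum_add_distrib, ite_mul, zero_mul, one_mul]
  rw [Finset.sum_ite_eq' , Finset.sum_ite_eq']
  cases z (f₁ k) <;> cases z (f₂ k) <;> simp

/-- The weights of the bits of a sum of two products of binary numbers. -/
def prodWeight (W : ℕ) (q : Bool × Fin W × Fin W) : ℕ := 2 ^ (q.2.1 : ℕ) * 2 ^ (q.2.2 : ℕ)

/-- Products of pairs of integers in depth one. -/
theorem exists_mul_circuit (U : Type) [Fintype U] (W : ℕ) :
    ∃ C : ThresholdCircuit ((Bool × U) × Bool × Fin W) (U × Bool × Bool × Fin W × Fin W),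
      C.depth ≤ 1 ∧ C.size = 4 * W ^ 2 * Fintype.card U ∧
      ∀ z val B, Represents (binWeight W) z val B →
        Represents (prodWeight W) (C.eval z) (fun x => val (true, x) * val (false, x))
          (2 * B ^ 2) := by
  obtain ⟨C, hd, hs, hC⟩ := exists_and_circuit
    (ι := (Bool × U) × Bool × Fin W) (g := U × Bool × Bool × Fin W × Fin W)
    (fun k => ((true, k.1), k.2.2.1, k.2.2.2.1))
    -- The rule of signs: the parts of the two factors agree for the positive part of the product
    -- and differ for the negative part.
    (fun k => ((false, k.1), k.2.2.1 == k.2.1, k.2.2.2.2))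
  refine ⟨C, hd, ?_, ?_⟩
  · rw [hs]
    simp only [Fintype.card_prod, Fintype.card_bool, Fintype.card_fin]
    ring
  intro z val B hz
  have hand : ∀ a b : Bool, (a && b).toNat = a.toNat * b.toNat := by decide
  have hpart : ∀ x s, partValue (prodWeight W) (C.eval z) x s =
      partValue (binWeight W) z (true, x) true * partValue (binWeight W) z (false, x) s +
      partValue (binWeight W) z (true, x) false * partValue (binWeight W) z (false, x) (!s) := by
    intro x s
    simp only [partValue, prodWeight, hC, binWeight, Fintype.sum_prod_type, Fintype.sum_bool,
      Finset.sum_mul_sum, hand]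
    congr 1 <;>
    · refine Finset.sum_congr rfl fun i _ => Finset.sum_congr rfl fun j _ => ?_
      cases s <;> simp <;> ring
  constructor
  · intro x
    rw [hpart, hpart, ← hz.eq, ← hz.eq]
    push_cast
    simp only [Bool.not_true, Bool.not_false]
    ring
  · intro x s
    rw [hpart]
    have h1 := Nat.mul_le_mul (hz.le (true, x) true) (hz.le (false, x) s)
    have h2 := Nat.mul_le_mul (hz.le (true, x) false) (hz.le (false, x) (!s))
    rw [sq]
    omega

/-! ### Kronecker products of sign matrices -/

section Kronecker

variable {I : Type} [Fintype I]

theorem SignType.coe_prod_int (f : I → SignType) : ((∏ i, f i : SignType) : ℤ) = ∏ i, (f i : ℤ) :=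
  map_prod (SignType.castHom (α := ℤ)) f Finset.univ

variable [DecidableEq I]

theorem prod_sum_eq_sum_pi_prod {R : Type*} [CommSemiring R] {κ : I → Type} [∀ i, Fintype (κ i)]
    (f : ∀ i, κ i → R) : ∏ i, ∑ x, f i x = ∑ g : ∀ i, κ i, ∏ i, f i (g i) := by
  rw [Finset.prod_univ_sum, Fintype.piFinset_univ]

/-- Signs have no zero divisors. Hence sparsity counts of Kronecker products factor over the
coordinates. -/
theorem SignType.support_prod (f : I → SignType) : (∏ i, f i).support = ∏ i, (f i).support := by
  have h : ∀ s : Finset I, (∏ i ∈ s, f i).support = ∏ i ∈ s, (f i).support := by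
    intro s
    induction s using Finset.induction_on with
    | empty => rfl
    | insert i s hi ih =>
      rw [Finset.prod_insert hi, Finset.prod_insert hi, ← ih]
      generalize f i = a
      generalize ∏ i ∈ s, f i = b
      revert a b
      decide
  exact h _

variable {X Y Z : I → Type}

/-- The Kronecker product of a family of sign matrices. -/
def kron (w : ∀ i, Y i → X i → SignType) (g : ∀ i, Y i) (f : ∀ i, X i) : SignType :=
  ∏ i, w i (g i) (f i)

variable [∀ i, Fintype (X i)]

theorem rowSupport_kron (w : ∀ i, Y i → X i → SignType) (g : ∀ i, Y i) :
    rowSupport (kron w) g = ∏ i, rowSupport (w i) (g i) := by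
  simp only [rowSupport, kron, SignType.support_prod]
  exact (prod_sum_eq_sum_pi_prod fun i x => (w i (g i) x).support).symm

theorem matSupport_kron [∀ i, Fintype (Y i)] (w : ∀ i, Y i → X i → SignType) :
    matSupport (kron w) = ∏ i, matSupport (w i) := by
  simp only [matSupport, rowSupport_kron]
  exact (prod_sum_eq_sum_pi_prod fun i y => rowSupport (w i) y).symm

/-- The mixed-product property: by distributivity, composition can be checked in each coordinate
separately. -/
theorem sum_kron_mul_kron (w : ∀ i, Y i → X i → SignType) (w' : ∀ i, X i → Z i → SignType)
    (w'' : ∀ i, Y i → Z i → SignType)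
    (h : ∀ i y z, ∑ x, (w i y x : ℤ) * (w' i x z : ℤ) = w'' i y z) (g : ∀ i, Y i)
    (e : ∀ i, Z i) : ∑ f, (kron w g f : ℤ) * (kron w' f e : ℤ) = kron w'' g e := by
  simp only [kron, SignType.coe_prod_int, ← h, ← Finset.prod_mul_distrib]
  exact (prod_sum_eq_sum_pi_prod fun i x => (w i (g i) x : ℤ) * (w' i x (e i) : ℤ)).symm

theorem sum_kron_one_mul [∀ i, DecidableEq (X i)] (w : ∀ i, X i → X i → SignType)
    (h : ∀ i y x, w i y x = if y = x then 1 else 0) (A : (∀ i, X i) → ℤ) (g : ∀ i, X i) :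
    ∑ f, (kron w g f : ℤ) * A f = A g := by
  have : ∀ f, kron w g f = if g = f then 1 else 0 := by
    intro f
    simp only [kron, h]
    split_ifs with hgf
    · exact Finset.prod_eq_one fun i _ => if_pos (congrFun hgf i)
    · obtain ⟨i, hi⟩ := Function.ne_iff.1 hgf
      exact Finset.prod_eq_zero (Finset.mem_univ i) (if_neg hi)
  rw [Finset.sum_eq_single g]
  · simp [this]
  · intro f _ hf
    simp [this, hf.symm]
  · exact fun h => absurd (Finset.mem_univ _) h

end Kronecker

/-! ### Levels of the recursion tree -/

section Levels

/-- The index set of one coordinate: a pair of indices of a `T × T` matrix before the algorithm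
has been applied to the coordinate, the index of a multiplication afterwards. -/
def Coord (T r : ℕ) : Bool → Type
  | false => Fin T × Fin T
  | true => Fin r

instance (T r : ℕ) : ∀ s, Fintype (Coord T r s)
  | false => inferInstanceAs (Fintype (Fin T × Fin T))
  | true => inferInstanceAs (Fintype (Fin r))

instance (T r : ℕ) : ∀ s, DecidableEq (Coord T r s)
  | false => inferInstanceAs (DecidableEq (Fin T × Fin T))
  | true => inferInstanceAs (DecidableEq (Fin r))

variable {T r : ℕ}

/-- The matrix of one coordinate in a step down the recursion tree. -/
def downMat (a : Fin r → Fin T → Fin T → SignType) :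
    ∀ s t, Coord T r t → Coord T r s → SignType
  | false, false => fun y x => if y = x then 1 else 0
  | true, true => fun y x => if y = x then 1 else 0
  | false, true => fun (y : Fin r) (x : Fin T × Fin T) => a y x.1 x.2
  | true, false => fun _ _ => 0

/-- The matrix of one coordinate in a step up the recursion tree. -/
def upMat (c : Fin r → Fin T → Fin T → SignType) :
    ∀ s t, Coord T r s → Coord T r t → SignType
  | false, false => fun y x => if y = x then 1 else 0
  | true, true => fun y x => if y = x then 1 else 0
  | false, true => fun (y : Fin T × Fin T) (x : Fin r) => c x y.1 y.2
  | true, false => fun _ _ => 0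

/-- A quantity that depends on the levels of a coordinate before and after a step. -/
def stepVal (p q s : ℕ) : Bool → Bool → ℕ
  | false, false => p
  | true, true => q
  | false, true => s
  | true, false => 0

theorem sum_one_mul_coe {X : Type} [Fintype X] [DecidableEq X] (F : X → SignType) (y : X) :
    ∑ x, ((if y = x then (1 : SignType) else 0 : SignType) : ℤ) * (F x : ℤ) = F y := by
  rw [Finset.sum_eq_single y]
  · simp
  · intro x _ hx
    simp [hx.symm]
  · exact fun h => absurd (Finset.mem_univ _) h

theorem sum_coe_mul_one {X : Type} [Fintype X] [DecidableEq X] (F : X → SignType) (y : X) :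
    ∑ x, (F x : ℤ) * ((if x = y then (1 : SignType) else 0 : SignType) : ℤ) = F y := by
  rw [Finset.sum_eq_single y]
  · simp
  · intro x _ hx
    simp [hx]
  · exact fun h => absurd (Finset.mem_univ _) h

/-- A coordinate is processed at most once, so one of the two factors is always an identity. -/
theorem downMat_mul (a : Fin r → Fin T → Fin T → SignType) (s t : Bool) (h : s = true → t = true)
    (y : Coord T r t) (z : Coord T r false) :
    ∑ x, (downMat a s t y x : ℤ) * (downMat a false s x z : ℤ) = downMat a false t y z := by
  cases s <;> cases t
  · exact sum_coe_mul_one _ _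
  · exact sum_coe_mul_one _ _
  · simp at h
  · exact sum_one_mul_coe (fun x => downMat a false true x z) _

theorem upMat_mul (c : Fin r → Fin T → Fin T → SignType) (s t : Bool) (h : s = true → t = true)
    (y : Coord T r s) (z : Coord T r true) :
    ∑ x, (upMat c s t y x : ℤ) * (upMat c t true x z : ℤ) = upMat c s true y z := by
  cases s <;> cases t
  · exact sum_one_mul_coe (fun x => upMat c false true x z) _
  · exact sum_coe_mul_one _ _
  · simp at h
  · exact sum_coe_mul_one _ _

theorem support_le_one (a : SignType) : a.support ≤ 1 := by
  revert a; decide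

theorem rowSupport_le_card {X Y : Type} [Fintype X] (w : Y → X → SignType) (y : Y) :
    rowSupport w y ≤ Fintype.card X :=
  (Finset.sum_le_sum fun x _ => support_le_one _).trans (by simp)

theorem rowSupport_one {X : Type} [Fintype X] [DecidableEq X] (y : X) :
    rowSupport (fun y x : X => if y = x then (1 : SignType) else 0) y = 1 := by
  rw [rowSupport, Finset.sum_eq_single y]
  · simp [SignType.support]
  · intro x _ hx
    simp [SignType.support, hx.symm]
  · exact fun h => absurd (Finset.mem_univ _) h

theorem matSupport_one {X : Type} [Fintype X] [DecidableEq X] :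
    matSupport (fun y x : X => if y = x then (1 : SignType) else 0) = Fintype.card X := by
  simp [matSupport, rowSupport_one]

theorem card_coord_false : Fintype.card (Coord T r false) = T ^ 2 :=
  (Fintype.card_prod (Fin T) (Fin T)).trans (by simp [sq])

theorem card_coord_true : Fintype.card (Coord T r true) = r :=
  Fintype.card_fin r

/-- Row counts only control the growth of the numbers, hence bit lengths, so crude bounds suffice.
-/
theorem rowSupport_downMat (a : Fin r → Fin T → Fin T → SignType) (s t : Bool)
    (y : Coord T r t) : rowSupport (downMat a s t) y ≤ stepVal 1 1 (T ^ 2) s t := by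
  cases s <;> cases t
  · exact (rowSupport_one y).le
  · exact (rowSupport_le_card _ _).trans card_coord_false.le
  · simp [rowSupport, downMat, SignType.support]
  · exact (rowSupport_one y).le

theorem rowSupport_upMat (c : Fin r → Fin T → Fin T → SignType) (s t : Bool)
    (y : Coord T r s) : rowSupport (upMat c s t) y ≤ stepVal 1 1 r s t := by
  cases s <;> cases t
  · exact (rowSupport_one y).le
  · exact (rowSupport_le_card _ _).trans card_coord_true.le
  · simp [rowSupport, upMat, SignType.support]
  · exact (rowSupport_one y).le

theorem sum_card_filter_ne_zero (a : Fin r → Fin T → Fin T → SignType) :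
    ∑ l, (Finset.univ.filter fun p : Fin T × Fin T => a l p.1 p.2 ≠ 0).card =
      ∑ l, ∑ p : Fin T × Fin T, (a l p.1 p.2).support := by
  refine Finset.sum_congr rfl fun l _ => ?_
  rw [Finset.card_filter]
  refine Finset.sum_congr rfl fun p _ => ?_
  rw [SignType.support]
  split_ifs <;> simp_all

theorem matSupport_downMat (a : Fin r → Fin T → Fin T → SignType) (s t : Bool) :
    matSupport (downMat a s t) = stepVal (T ^ 2) r
      (∑ l, (Finset.univ.filter fun p : Fin T × Fin T => a l p.1 p.2 ≠ 0).card) s t := by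
  cases s <;> cases t
  · exact matSupport_one.trans card_coord_false
  · exact (sum_card_filter_ne_zero a).symm
  · simp [matSupport, rowSupport, downMat, SignType.support, stepVal]
  · exact matSupport_one.trans card_coord_true

theorem matSupport_upMat (c : Fin r → Fin T → Fin T → SignType) (s t : Bool) :
    matSupport (upMat c s t) = stepVal (T ^ 2) r
      (∑ l, (Finset.univ.filter fun p : Fin T × Fin T => c l p.1 p.2 ≠ 0).card) s t := by
  cases s <;> cases t
  · exact matSupport_one.trans card_coord_false
  · exact Finset.sum_comm.trans (sum_card_filter_ne_zero c).symm
  · simp [matSupport, rowSupport, upMat, SignType.support, stepVal]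
  · exact matSupport_one.trans card_coord_true

theorem stepVal_mono (p q : ℕ) {s s' : ℕ} (h : s ≤ s') (b c : Bool) :
    stepVal p q s b c ≤ stepVal p q s' b c := by
  cases b <;> cases c <;> simp [stepVal, h]

/-- The coordinates below `h` are those to which the algorithm has been applied. -/
def levelSet (L h : ℕ) (i : Fin L) : Bool := decide ((i : ℕ) < h)

/-- The coordinates split into three blocks: processed earlier, processed in this step, still
untouched. -/
theorem prod_levelSet {L h h' : ℕ} (h1 : h ≤ h') (h2 : h' ≤ L) (F : Bool → Bool → ℕ) :
    ∏ i, F (levelSet L h i) (levelSet L h' i) =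
      F true true ^ h * F false true ^ (h' - h) * F false false ^ (L - h') := by
  obtain ⟨m, rfl⟩ := Nat.exists_eq_add_of_le h1
  obtain ⟨n, rfl⟩ := Nat.exists_eq_add_of_le h2
  rw [Nat.add_sub_cancel_left, Nat.add_sub_cancel_left]
  simp only [levelSet]
  rw [Fin.prod_univ_eq_prod_range (fun i => F (decide (i < h)) (decide (i < h + m))) (h + m + n),
    Finset.prod_range_add, Finset.prod_range_add]
  congr 1
  · congr 1
    · conv_rhs => rw [← Finset.card_range h, ← Finset.prod_const]
      refine Finset.prod_congr rfl fun i hi => ?_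
      have := Finset.mem_range.1 hi
      rw [decide_eq_true this, decide_eq_true (by omega)]
    · conv_rhs => rw [← Finset.card_range m, ← Finset.prod_const]
      refine Finset.prod_congr rfl fun i hi => ?_
      have := Finset.mem_range.1 hi
      rw [decide_eq_false (by omega), decide_eq_true (by omega)]
  · conv_rhs => rw [← Finset.card_range n, ← Finset.prod_const]
    refine Finset.prod_congr rfl fun i hi => ?_
    rw [decide_eq_false (by omega), decide_eq_false (by omega)]

theorem levelSet_mono {L h h' : ℕ} (h1 : h ≤ h') (i : Fin L) :
    levelSet L h i = true → levelSet L h' i = true := by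
  simp only [levelSet, decide_eq_true_eq]
  omega

theorem prod_stepVal_levelSet {L h h' : ℕ} (h1 : h ≤ h') (h2 : h' ≤ L) (p q s : ℕ) :
    ∏ i, stepVal p q s (levelSet L h i) (levelSet L h' i) = q ^ h * s ^ (h' - h) * p ^ (L - h') :=
  prod_levelSet h1 h2 _

/-- The index set of a level of the recursion tree: a node together with an entry of its matrix. -/
abbrev Node (T r : ℕ) {L : ℕ} (σ : Fin L → Bool) : Type := ∀ i, Coord T r (σ i)

/-- Each output of a linear step also costs gates; because r and T^2 are at most s, their number
obeys the bound for the nonzero entries. -/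
theorem card_node_levelSet_le {L h h' : ℕ} (h1 : h ≤ h') (h2 : h' ≤ L) {s : ℕ}
    (hs : r ≤ s) (hT : T ^ 2 ≤ s) :
    Fintype.card (Node T r (levelSet L h)) ≤ r ^ h * s ^ (h' - h) * (T ^ 2) ^ (L - h') ∧
    Fintype.card (Node T r (levelSet L h')) ≤ r ^ h * s ^ (h' - h) * (T ^ 2) ^ (L - h') := by
  rw [Fintype.card_pi, Fintype.card_pi, ← prod_stepVal_levelSet h1 h2]
  constructor <;> refine Finset.prod_le_prod' fun i _ => ?_
  all_goals
    have := levelSet_mono h1 i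
    revert this
    cases levelSet L h i <;> cases levelSet L h' i <;>
      simp [stepVal, card_coord_false, card_coord_true, hs, hT]

end Levels

/-! ### Tensor powers of the algorithm -/

section Bilinear

variable {T r : ℕ} (M : MatMulAlgorithm T r)

/-- The trilinear form of a matrix multiplication algorithm. -/
theorem MatMulAlgorithm.sum_mul_eq (x p q : Fin T × Fin T) :
    ∑ l, (M.c l x.1 x.2 : ℤ) * ((M.a l p.1 p.2 : ℤ) * (M.b l q.1 q.2 : ℤ)) =
      if p.1 = x.1 ∧ p.2 = q.1 ∧ q.2 = x.2 then 1 else 0 := by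
  -- Evaluating at matrix units extracts the coefficients of the bilinear identity.
  have h := M.correct (Matrix.single p.1 p.2 1) (Matrix.single q.1 q.2 1) x.1 x.2
  have e : ∀ (w : Fin T → Fin T → SignType) (p : Fin T × Fin T),
      ∑ i, ∑ j, (w i j : ℤ) * Matrix.single p.1 p.2 (1 : ℤ) i j = w p.1 p.2 := by
    intro w p
    simp [Matrix.single_apply, ite_and]
  simp only [e] at h
  rw [← h, Matrix.mul_apply]
  simp only [Matrix.single_apply, mul_ite, mul_one, mul_zero]
  rw [Finset.sum_eq_single q.1]
  · simp only [true_and]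
    split_ifs <;> simp_all
  · intro k _ hk
    simp [hk.symm]
  · exact fun h => absurd (Finset.mem_univ _) h

/-- The Kronecker power of a matrix multiplication algorithm multiplies matrices. -/
theorem MatMulAlgorithm.sum_prod_mul_eq {L : ℕ}
    (A B : (Fin L → Fin T) → (Fin L → Fin T) → ℤ) (x : Fin L → Fin T × Fin T) :
    ∑ u : Fin L → Fin r, (∏ i, (M.c (u i) (x i).1 (x i).2 : ℤ)) *
      ((∑ p : Fin L → Fin T × Fin T, (∏ i, (M.a (u i) (p i).1 (p i).2 : ℤ)) *
          A (fun i => (p i).1) (fun i => (p i).2)) *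
        ∑ q : Fin L → Fin T × Fin T, (∏ i, (M.b (u i) (q i).1 (q i).2 : ℤ)) *
          B (fun i => (q i).1) (fun i => (q i).2)) =
      ∑ k, A (fun i => (x i).1) k * B k (fun i => (x i).2) := by
  -- The sum over `u` factors over the coordinates, and each factor is the trilinear identity for a
  -- single coordinate.
  have h1 : ∀ p q : Fin L → Fin T × Fin T,
      ∑ u : Fin L → Fin r, (∏ i, (M.c (u i) (x i).1 (x i).2 : ℤ)) *
        ((∏ i, (M.a (u i) (p i).1 (p i).2 : ℤ)) * ∏ i, (M.b (u i) (q i).1 (q i).2 : ℤ)) =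
      if (fun i => (p i).1) = (fun i => (x i).1) ∧ (fun i => (p i).2) = (fun i => (q i).1) ∧
        (fun i => (q i).2) = (fun i => (x i).2) then 1 else 0 := by
    intro p q
    simp only [← Finset.prod_mul_distrib]
    rw [← prod_sum_eq_sum_pi_prod fun i l => (M.c l (x i).1 (x i).2 : ℤ) *
      ((M.a l (p i).1 (p i).2 : ℤ) * (M.b l (q i).1 (q i).2 : ℤ))]
    simp only [M.sum_mul_eq, Finset.prod_ite_zero, Finset.prod_const_one, funext_iff,
      ← forall_and, Finset.mem_univ, forall_true_left]
  have h2 : ∀ F : (Fin L → Fin T × Fin T) → ℤ, ∑ p, F p =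
      ∑ p₁ : Fin L → Fin T, ∑ p₂ : Fin L → Fin T, F fun i => (p₁ i, p₂ i) := by
    intro F
    rw [← Fintype.sum_prod_type' (f := fun p₁ p₂ : Fin L → Fin T => F fun i => (p₁ i, p₂ i))]
    exact Fintype.sum_equiv (Equiv.arrowProdEquivProdArrow (Fin L) (fun _ => Fin T) fun _ => Fin T)
      _ _ fun _ => rfl
  calc _ = ∑ p : Fin L → Fin T × Fin T, ∑ q : Fin L → Fin T × Fin T,
        (A (fun i => (p i).1) (fun i => (p i).2) * B (fun i => (q i).1) (fun i => (q i).2)) *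
        ∑ u : Fin L → Fin r, (∏ i, (M.c (u i) (x i).1 (x i).2 : ℤ)) *
        ((∏ i, (M.a (u i) (p i).1 (p i).2 : ℤ)) * ∏ i, (M.b (u i) (q i).1 (q i).2 : ℤ)) := by
        simp only [Finset.sum_mul_sum]
        simp only [Finset.mul_sum]
        rw [Finset.sum_comm]
        refine Finset.sum_congr rfl fun p _ => ?_
        rw [Finset.sum_comm]
        refine Finset.sum_congr rfl fun q _ => Finset.sum_congr rfl fun u _ => ?_
        ring
    _ = _ := by
        simp only [h1, h2, mul_ite, mul_one, mul_zero, ite_and]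
        rw [Finset.sum_eq_single (fun i => (x i).1)]
        · refine Finset.sum_congr rfl fun k _ => ?_
          rw [Finset.sum_eq_single k]
          · rw [Finset.sum_eq_single (fun i => (x i).2)]
            · simp
            · intro k' _ hk
              simp [hk]
            · exact fun h => absurd (Finset.mem_univ _) h
          · intro k' _ hk
            simp [hk.symm]
          · exact fun h => absurd (Finset.mem_univ _) h
        · intro k' _ hk
          simp [hk]
        · exact fun h => absurd (Finset.mem_univ _) h

end Bilinear

/-! ### Chains of linear steps -/

/-- There is a circuit with depth at most `d` and at most `n` gates that computes the integers
`val`, as differences of nonnegative integers that are at most `B`. -/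
def HasCircuit {ι X Q : Type} [Fintype ι] [Fintype Q] (v : Q → ℕ) (val : (ι → Bool) → X → ℤ)
    (B d n : ℕ) : Prop :=
  ∃ C : ThresholdCircuit ι (X × Bool × Q), C.depth ≤ d ∧ C.size ≤ n ∧
    ∀ x, Represents v (C.eval x) (val x) B

section Chain

variable {ι : Type} [Fintype ι]

/-- The allowance of 2W^2 weighted bits per part admits products of binary numbers that have not
been summed up; this keeps the multiplication at depth one. -/
theorem HasCircuit.linear {X Y Q : Type} [Fintype X] [Fintype Y] [Fintype Q] {v : Q → ℕ}
    {val : (ι → Bool) → X → ℤ} {B d n : ℕ} (h : HasCircuit v val B d n) (w : Y → X → SignType)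
    {val' : (ι → Bool) → Y → ℤ} (hval : ∀ x y, ∑ x', (w y x' : ℤ) * val x x' = val' x y)
    {m W S : ℕ} (hm : ∀ y, rowSupport w y ≤ m) (hB : m * B < 2 ^ W)
    (hQ : Fintype.card Q ≤ 2 * W ^ 2) (hS : matSupport w ≤ S) (hY : Fintype.card Y ≤ S) :
    HasCircuit (binWeight W) val' (m * B) (d + 2) (n + (8 * W ^ 3 + 2 * W) * S) := by
  obtain ⟨C, hd, hs, hC⟩ := h
  obtain ⟨D, hd', hs', hD⟩ := exists_linear_circuit w v W
  refine ⟨C.comp D, (comp_depth_le _ _).trans (add_le_add hd hd'), ?_, fun x => ?_⟩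
  · rw [comp_size]
    refine add_le_add hs (hs'.trans ?_)
    calc _ ≤ 4 * W * (2 * W ^ 2) * S + 2 * W * S := by gcongr
      _ = _ := by ring
  · rw [comp_eval, ← funext (hval x)]
    exact hD _ _ _ _ (hC x) hm hB

theorem HasCircuit.mul {U : Type} [Fintype U] {W : ℕ} {val : (ι → Bool) → Bool × U → ℤ}
    {B d n : ℕ} (h : HasCircuit (binWeight W) val B d n) :
    HasCircuit (prodWeight W) (fun x u => val x (true, u) * val x (false, u)) (2 * B ^ 2) (d + 1)
      (n + 4 * W ^ 2 * Fintype.card U) := by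
  obtain ⟨C, hd, hs, hC⟩ := h
  obtain ⟨D, hd', hs', hD⟩ := exists_mul_circuit U W
  refine ⟨C.comp D, (comp_depth_le _ _).trans (add_le_add hd hd'), ?_, fun x => ?_⟩
  · rw [comp_size]
    exact add_le_add hs hs'.le
  · rw [comp_eval]
    exact hD _ _ _ (hC x)

/-- A sequence of sparse linear maps. -/
theorem HasCircuit.chain {X : ℕ → Type} [∀ i, Fintype (X i)] {val : ∀ i, (ι → Bool) → X i → ℤ}
    {w : ∀ i, X (i + 1) → X i → SignType} {m B : ℕ → ℕ} {W S d δ n : ℕ} {Q : Type} [Fintype Q]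
    {v : Q → ℕ} (h : HasCircuit v (val 0) (B 0) δ n) (hQ : Fintype.card Q ≤ 2 * W ^ 2)
    (hd : 1 ≤ d) (hval : ∀ i < d, ∀ x y, ∑ x', (w i y x' : ℤ) * val i x x' = val (i + 1) x y)
    (hm : ∀ i < d, ∀ y, rowSupport (w i) y ≤ m i) (hB : ∀ i < d, m i * B i = B (i + 1))
    (hW : ∀ i < d, B (i + 1) < 2 ^ W) (hS : ∀ i < d, matSupport (w i) ≤ S)
    (hX : ∀ i < d, Fintype.card (X (i + 1)) ≤ S) :
    HasCircuit (binWeight W) (val d) (B d) (δ + 2 * d) (n + d * ((8 * W ^ 3 + 2 * W) * S)) := by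
  -- The bit format is existentially quantified, since only the initial values may fail to be in
  -- binary.
  have step : ∀ i < d, (∃ (Q : Type) (_ : Fintype Q) (v : Q → ℕ), Fintype.card Q ≤ 2 * W ^ 2 ∧
      HasCircuit v (val i) (B i) (δ + 2 * i) (n + i * ((8 * W ^ 3 + 2 * W) * S))) →
      HasCircuit (binWeight W) (val (i + 1)) (B (i + 1)) (δ + 2 * (i + 1))
        (n + (i + 1) * ((8 * W ^ 3 + 2 * W) * S)) := by
    rintro i hi ⟨Q, _, v, hQ, h⟩
    have := h.linear (w i) (hval i hi) (hm i hi) (by rw [hB i hi]; exact hW i hi) hQ (hS i hi)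
      (hX i hi)
    rw [hB i hi] at this
    convert this using 1 <;> ring
  have all : ∀ i ≤ d, ∃ (Q : Type) (_ : Fintype Q) (v : Q → ℕ), Fintype.card Q ≤ 2 * W ^ 2 ∧
      HasCircuit v (val i) (B i) (δ + 2 * i) (n + i * ((8 * W ^ 3 + 2 * W) * S)) := by
    intro i
    induction i with
    | zero => exact fun _ => ⟨Q, inferInstance, v, hQ, by simpa using h⟩
    | succ i ih =>
      intro hi
      refine ⟨Fin W, inferInstance, binWeight W, ?_, step i hi (ih (by omega))⟩
      rw [Fintype.card_fin]
      nlinarith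
  obtain ⟨k, rfl⟩ := Nat.exists_eq_add_of_le' hd
  exact step k (by omega) (all k (by omega))

end Chain

section BinaryInput

theorem cast_partValue_binWeight {X : Type} {W : ℕ} (z : X × Bool × Fin W → Bool) (x : X)
    (s : Bool) : (partValue (binWeight W) z x s : ℤ) =
      ∑ k : Fin W, 2 ^ (k : ℕ) * (if z (x, s, k) then 1 else 0) := by
  rw [partValue, Nat.cast_sum]
  refine Finset.sum_congr rfl fun k _ => ?_
  cases z (x, s, k) <;> simp [binWeight]

theorem partValue_binWeight_le {X : Type} {W : ℕ} (z : X × Bool × Fin W → Bool) (x : X)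
    (s : Bool) : partValue (binWeight W) z x s ≤ 2 ^ W := by
  refine (Finset.sum_le_sum fun k _ => Nat.mul_le_mul_left _ (Bool.toNat_le _)).trans ?_
  simp only [binWeight, mul_one]
  rw [Fin.sum_univ_eq_sum_range (fun k => 2 ^ k) W]
  have := Nat.geomSum_lt (m := 2) le_rfl (s := Finset.range W) (n := W) (by simp)
  exact this.le

end BinaryInput

/-! ### Steps down and up the recursion tree -/

namespace MatMulAlgorithm

variable {T r : ℕ} (M : MatMulAlgorithm T r) {L : ℕ}

/-- The coefficients of the linear forms of `A` (for `true`) and of `B` (for `false`). -/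
def forms (tag : Bool) : Fin r → Fin T → Fin T → SignType := if tag then M.a else M.b

/-- One step down the recursion tree, for both factors simultaneously. -/
def downStep (σ τ : Fin L → Bool) (y : Bool × Node T r τ) (x : Bool × Node T r σ) : SignType :=
  if x.1 = y.1 then kron (fun i => downMat (M.forms y.1) (σ i) (τ i)) y.2 x.2 else 0

/-- One step up the recursion tree. -/
def upStep (σ τ : Fin L → Bool) : Node T r σ → Node T r τ → SignType :=
  kron fun i => upMat M.c (σ i) (τ i)

/-- The matrices of a level of the recursion tree. -/
def downVal (A : Bool × Node T r (fun _ : Fin L => false) → ℤ) (σ : Fin L → Bool)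
    (y : Bool × Node T r σ) : ℤ :=
  ∑ p, (kron (fun i => downMat (M.forms y.1) false (σ i)) y.2 p : ℤ) * A (y.1, p)

/-- The products of the matrices of a level of the recursion tree. -/
def upVal (P : Node T r (fun _ : Fin L => true) → ℤ) (σ : Fin L → Bool) (y : Node T r σ) : ℤ :=
  ∑ u, (kron (fun i => upMat M.c (σ i) true) y u : ℤ) * P u

theorem rowSupport_downStep (σ τ : Fin L → Bool) (y : Bool × Node T r τ) :
    rowSupport (M.downStep σ τ) y =
      rowSupport (kron fun i => downMat (M.forms y.1) (σ i) (τ i)) y.2 := by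
  obtain ⟨t, y⟩ := y
  rw [rowSupport, Fintype.sum_prod_type, Fintype.sum_bool]
  cases t <;> simp [downStep, rowSupport, SignType.support]

/-- Each level is defined directly from the inputs; the composition law for Kronecker products shows
that the steps link these levels. -/
theorem downStep_downVal (A : Bool × Node T r (fun _ : Fin L => false) → ℤ) (σ τ : Fin L → Bool)
    (h : ∀ i, σ i = true → τ i = true) (y : Bool × Node T r τ) :
    ∑ x, (M.downStep σ τ y x : ℤ) * M.downVal A σ x = M.downVal A τ y := by
  obtain ⟨t, y⟩ := y
  have h1 : ∑ x, (M.downStep σ τ (t, y) x : ℤ) * M.downVal A σ x =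
      ∑ f, (kron (fun i => downMat (M.forms t) (σ i) (τ i)) y f : ℤ) * M.downVal A σ (t, f) := by
    rw [Fintype.sum_prod_type, Fintype.sum_bool]
    cases t <;> simp [downStep]
  rw [h1]
  simp only [downVal, Finset.mul_sum]
  rw [Finset.sum_comm]
  refine Finset.sum_congr rfl fun p _ => ?_
  rw [← sum_kron_mul_kron _ _ _ (fun i => downMat_mul (M.forms t) (σ i) (τ i) (h i)) y p,
    Finset.sum_mul]
  exact Finset.sum_congr rfl fun f _ => (mul_assoc _ _ _).symm

theorem upStep_upVal (P : Node T r (fun _ : Fin L => true) → ℤ) (σ τ : Fin L → Bool)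
    (h : ∀ i, σ i = true → τ i = true) (y : Node T r σ) :
    ∑ x, (M.upStep σ τ y x : ℤ) * M.upVal P τ x = M.upVal P σ y := by
  simp only [upVal, upStep, Finset.mul_sum]
  rw [Finset.sum_comm]
  refine Finset.sum_congr rfl fun p _ => ?_
  rw [← sum_kron_mul_kron _ _ _ (fun i => upMat_mul M.c (σ i) (τ i) (h i)) y p, Finset.sum_mul]
  exact Finset.sum_congr rfl fun f _ => (mul_assoc _ _ _).symm

theorem downVal_false (A : Bool × Node T r (fun _ : Fin L => false) → ℤ) :
    M.downVal A (fun _ => false) = A := by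
  funext ⟨t, y⟩
  exact sum_kron_one_mul (X := fun _ : Fin L => Coord T r false) _ (fun _ _ _ => rfl)
    (fun p => A (t, p)) y

theorem upVal_true (P : Node T r (fun _ : Fin L => true) → ℤ) :
    M.upVal P (fun _ => true) = P := by
  funext y
  exact sum_kron_one_mul (X := fun _ : Fin L => Coord T r true) _ (fun _ _ _ => rfl) P y

variable {h h' : ℕ} (h1 : h ≤ h') (h2 : h' ≤ L)
include h1 h2

theorem rowSupport_downStep_le (y : Bool × Node T r (levelSet L h')) :
    rowSupport (M.downStep (levelSet L h) (levelSet L h')) y ≤ (T ^ 2) ^ (h' - h) := by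
  rw [rowSupport_downStep, rowSupport_kron]
  refine (Finset.prod_le_prod' fun i _ => rowSupport_downMat _ _ _ _).trans ?_
  rw [prod_stepVal_levelSet h1 h2, one_pow, one_pow, one_mul, mul_one]

theorem rowSupport_upStep_le (y : Node T r (levelSet L h)) :
    rowSupport (M.upStep (levelSet L h) (levelSet L h')) y ≤ r ^ (h' - h) := by
  rw [upStep, rowSupport_kron]
  refine (Finset.prod_le_prod' fun i _ => rowSupport_upMat _ _ _ _).trans ?_
  rw [prod_stepVal_levelSet h1 h2, one_pow, one_pow, one_mul, mul_one]

theorem matSupport_downStep_le :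
    matSupport (M.downStep (levelSet L h) (levelSet L h')) ≤
      2 * (r ^ h * M.sparsity ^ (h' - h) * (T ^ 2) ^ (L - h')) := by
  have key : ∀ t, matSupport (kron fun i => downMat (M.forms t) (levelSet L h i)
      (levelSet L h' i)) ≤ r ^ h * M.sparsity ^ (h' - h) * (T ^ 2) ^ (L - h') := by
    intro t
    rw [matSupport_kron, ← prod_stepVal_levelSet h1 h2]
    refine Finset.prod_le_prod' fun i _ => ?_
    rw [matSupport_downMat]
    refine stepVal_mono _ _ ?_ _ _
    cases t
    · exact (le_max_left _ _).trans (le_max_right _ _)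
    · exact le_max_left _ _
  rw [matSupport, Fintype.sum_prod_type, Fintype.sum_bool, two_mul]
  simp only [rowSupport_downStep]
  exact add_le_add (key true) (key false)

theorem matSupport_upStep_le :
    matSupport (M.upStep (levelSet L h) (levelSet L h')) ≤
      r ^ h * M.sparsity ^ (h' - h) * (T ^ 2) ^ (L - h') := by
  rw [upStep, matSupport_kron, ← prod_stepVal_levelSet h1 h2]
  refine Finset.prod_le_prod' fun i _ => ?_
  rw [matSupport_upMat]
  exact stepVal_mono _ _ ((le_max_right _ _).trans (le_max_right _ _)) _ _

end MatMulAlgorithm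

/-! ### The circuit for given levels -/

namespace MatMulAlgorithm

variable {T r : ℕ} (M : MatMulAlgorithm T r) {L : ℕ}

/-- The row index of an entry of the input matrices. -/
def rowIndex (p : Node T r (fun _ : Fin L => false)) : Fin (T ^ L) :=
  finFunctionFinEquiv fun i => Prod.fst (α := Fin T) (β := Fin T) (p i)

/-- The column index of an entry of the input matrices. -/
def colIndex (p : Node T r (fun _ : Fin L => false)) : Fin (T ^ L) :=
  finFunctionFinEquiv fun i => Prod.snd (α := Fin T) (β := Fin T) (p i)

/-- The position with given row and column indices. -/
def entryIndex (r : ℕ) (i j : Fin (T ^ L)) : Node T r (fun _ : Fin L => false) := fun t =>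
  ((finFunctionFinEquiv.symm i t, finFunctionFinEquiv.symm j t) : Fin T × Fin T)

theorem rowIndex_entryIndex (i j : Fin (T ^ L)) : rowIndex (entryIndex r i j) = i :=
  finFunctionFinEquiv.apply_symm_apply i

theorem colIndex_entryIndex (i j : Fin (T ^ L)) : colIndex (entryIndex r i j) = j :=
  finFunctionFinEquiv.apply_symm_apply j

/-- The positions of the bits of the two input matrices. -/
def inputIndex {ν : Type} (t : Bool) (j : ν) : ν ⊕ ν := if t then Sum.inl j else Sum.inr j

/-- The two input matrices. -/
def inputVal (r : ℕ) {b : ℕ} (x : MatrixBits (T ^ L) b ⊕ MatrixBits (T ^ L) b → Bool)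
    (y : Bool × Node T r (fun _ : Fin L => false)) : ℤ :=
  decodeMatrix (fun j => x (inputIndex y.1 j)) (rowIndex y.2) (colIndex y.2)

theorem hasCircuit_inputVal (r b : ℕ) :
    HasCircuit (binWeight b) (inputVal (T := T) (L := L) r (b := b)) (2 ^ b) 0 0 := by
  refine ⟨wires fun k => inputIndex k.1.1 (rowIndex k.1.2, colIndex k.1.2, k.2.1, k.2.2),
    (wires_depth _).le, (wires_size _).le, fun x => ⟨fun y => ?_, fun y s =>
      partValue_binWeight_le _ _ _⟩⟩
  rw [cast_partValue_binWeight, cast_partValue_binWeight]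
  rfl

/-- Base-T digits identify row and column numbers with L-tuples of indices, and the tensor power
identity applies. -/
theorem upVal_downVal {b : ℕ} (x y : MatrixBits (T ^ L) b → Bool) (i j : Fin (T ^ L)) :
    M.upVal (fun u => M.downVal (inputVal r (Sum.elim x y)) (fun _ => true) (true, u) *
      M.downVal (inputVal r (Sum.elim x y)) (fun _ => true) (false, u)) (fun _ => false)
      (entryIndex r i j) = (decodeMatrix x * decodeMatrix y) i j := by
  have h := M.sum_prod_mul_eq (L := L)
    (fun p q => decodeMatrix x (finFunctionFinEquiv p) (finFunctionFinEquiv q))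
    (fun p q => decodeMatrix y (finFunctionFinEquiv p) (finFunctionFinEquiv q))
    (entryIndex r i j)
  rw [Matrix.mul_apply, ← Equiv.sum_comp finFunctionFinEquiv]
  refine Eq.trans ?_ (h.trans ?_)
  · simp only [upVal, downVal, kron, SignType.coe_prod_int]
    rfl
  · have e1 := rowIndex_entryIndex (r := r) i j
    have e2 := colIndex_entryIndex (r := r) i j
    rw [rowIndex] at e1
    rw [colIndex] at e2
    refine Finset.sum_congr rfl fun k _ => ?_
    exact congrArg₂ (· * ·) (congrArg (fun t => decodeMatrix x t _) e1)
      (congrArg (fun t => decodeMatrix y _ t) e2)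

/-- A number of bits that suffices for all the intermediate results. -/
def width (T r L b : ℕ) : ℕ := 2 * b + 2 + T ^ 4 * r * L

/-- The left side bounds every part at the end of the computation: down to the leaves the bound 2^b
grows by (T^2)^L, a product gives twice the square, and the way up gives r^L. -/
theorem lt_two_pow_width (T r L b : ℕ) :
    2 * (2 ^ b * (T ^ 2) ^ L) ^ 2 * r ^ L < 2 ^ width T r L b := by
  have h1 : (T ^ 4 * r) ^ L ≤ 2 ^ (T ^ 4 * r * L) := by
    rw [pow_mul]
    exact Nat.pow_le_pow_left Nat.lt_two_pow_self.le L
  have h2 : 2 * (2 ^ b * (T ^ 2) ^ L) ^ 2 * r ^ L = 2 * 2 ^ (2 * b) * (T ^ 4 * r) ^ L := by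
    rw [mul_pow, mul_pow (T ^ 4)]
    ring
  have h3 : 2 ^ width T r L b = 4 * 2 ^ (2 * b) * 2 ^ (T ^ 4 * r * L) := by
    rw [width]
    ring
  rw [h2, h3]
  have : 0 < 2 ^ (2 * b) * 2 ^ (T ^ 4 * r * L) := by positivity
  nlinarith [Nat.mul_le_mul_left (2 ^ (2 * b)) h1]

variable {b d S : ℕ} {h : ℕ → ℕ}

/-- The circuit for a given sequence of levels of the recursion tree. -/
theorem exists_circuit (hT : 1 ≤ T) (hr : T ^ 2 ≤ r) (hs : r ≤ M.sparsity) (hd : 1 ≤ d)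
    (hmono : Monotone h) (h0 : h 0 = 0) (hL : h d = L)
    (hS : ∀ i < d, r ^ h i * M.sparsity ^ (h (i + 1) - h i) * (T ^ 2) ^ (L - h (i + 1)) ≤ S) :
    ∃ C : ThresholdCircuit (MatrixBits (T ^ L) b ⊕ MatrixBits (T ^ L) b)
        (MatrixBits (T ^ L) (width T r L b)),
      C.ComputesMatMul ∧ C.depth ≤ 4 * d + 1 ∧ C.size ≤ 34 * width T r L b ^ 3 * (d * S) := by
  set W := width T r L b
  have hT2 : 1 ≤ T ^ 2 := Nat.one_le_pow _ _ hT
  have hr1 : 1 ≤ r := hT2.trans hr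
  have hW2 : 2 * b + 2 ≤ W := Nat.le_add_right _ _
  have hle : ∀ i ≤ d, h i ≤ L := fun i hi => hL ▸ hmono hi
  have hlt := lt_two_pow_width T r L b
  have hbig : 2 ^ b * (T ^ 2) ^ L < 2 ^ W := by
    refine lt_of_le_of_lt ?_ hlt
    have h1 : 1 ≤ 2 ^ b * (T ^ 2) ^ L := Nat.mul_pos (by positivity) (by positivity)
    have h2 : 1 ≤ r ^ L := Nat.one_le_pow _ _ hr1
    nlinarith [Nat.mul_le_mul (Nat.mul_le_mul_left 2 (Nat.mul_le_mul h1 (le_refl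
      (2 ^ b * (T ^ 2) ^ L)))) h2]
  have hcard : ∀ i < d, Fintype.card (Node T r (levelSet L (h i))) ≤ S ∧
      Fintype.card (Node T r (levelSet L (h (i + 1)))) ≤ S := by
    intro i hi
    have := card_node_levelSet_le (T := T) (r := r) (hmono i.le_succ) (hle _ hi) hs
      (hr.trans hs)
    exact ⟨this.1.trans (hS i hi), this.2.trans (hS i hi)⟩
  have e0 : levelSet L (h 0) = fun _ => false := by
    funext i; simp [levelSet, h0]
  have eL : levelSet L (h d) = fun _ => true := by
    funext i; simp [levelSet, hL]
  -- down the recursion tree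
  have down : HasCircuit (binWeight W)
      (fun x => M.downVal (inputVal r (b := b) x) (levelSet L (h d)))
      (2 ^ b * (T ^ 2) ^ h d) (0 + 2 * d) (0 + d * ((8 * W ^ 3 + 2 * W) * (2 * S))) := by
    refine HasCircuit.chain (X := fun i => Bool × Node T r (levelSet L (h i)))
      (val := fun i x => M.downVal (inputVal r (b := b) x) (levelSet L (h i)))
      (w := fun i => M.downStep (levelSet L (h i)) (levelSet L (h (i + 1))))
      (m := fun i => (T ^ 2) ^ (h (i + 1) - h i)) (B := fun i => 2 ^ b * (T ^ 2) ^ h i)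
      (v := binWeight b) ?_ ?_ hd ?_ ?_ ?_ ?_ ?_ ?_
    · rw [e0, h0, pow_zero, mul_one]
      simp only [downVal_false]
      exact hasCircuit_inputVal r b
    · rw [Fintype.card_fin]
      nlinarith
    · exact fun i hi x y => M.downStep_downVal _ _ _ (levelSet_mono (hmono i.le_succ)) y
    · exact fun i hi y => M.rowSupport_downStep_le (hmono i.le_succ) (hle _ hi) y
    · intro i hi
      have := hmono i.le_succ
      rw [mul_left_comm, ← pow_add, Nat.sub_add_cancel this]
    · intro i hi
      refine lt_of_le_of_lt ?_ hbig
      exact Nat.mul_le_mul_left _ (Nat.pow_le_pow_right hT2 (hle _ hi))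
    · intro i hi
      exact (M.matSupport_downStep_le (hmono i.le_succ) (hle _ hi)).trans
        (Nat.mul_le_mul_left 2 (hS i hi))
    · intro i hi
      rw [Fintype.card_prod, Fintype.card_bool]
      exact Nat.mul_le_mul_left 2 (hcard i hi).2
  have cardL : Fintype.card (Node T r (fun _ : Fin L => true)) ≤ S := by
    have := (hcard (d - 1) (by omega)).2
    rw [Nat.sub_add_cancel hd] at this
    rw [eL] at this
    exact this
  rw [eL, hL] at down
  have prod := down.mul
  -- up the recursion tree
  have up : HasCircuit (binWeight W)
      (fun x => M.upVal (fun u =>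
        M.downVal (inputVal r (b := b) x) (fun _ => true) (true, u) *
        M.downVal (inputVal r (b := b) x) (fun _ => true) (false, u)) (levelSet L (h (d - d))))
      (2 * (2 ^ b * (T ^ 2) ^ L) ^ 2 * r ^ (L - h (d - d))) (0 + 2 * d + 1 + 2 * d)
      (0 + d * ((8 * W ^ 3 + 2 * W) * (2 * S)) +
        4 * W ^ 2 * Fintype.card (Node T r (fun _ : Fin L => true)) +
        d * ((8 * W ^ 3 + 2 * W) * S)) := by
    refine HasCircuit.chain (X := fun i => Node T r (levelSet L (h (d - i))))
      (val := fun i x => M.upVal (fun u =>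
        M.downVal (inputVal r (b := b) x) (fun _ => true) (true, u) *
        M.downVal (inputVal r (b := b) x) (fun _ => true) (false, u)) (levelSet L (h (d - i))))
      (w := fun i => M.upStep (levelSet L (h (d - (i + 1)))) (levelSet L (h (d - i))))
      (m := fun i => r ^ (h (d - i) - h (d - (i + 1))))
      (B := fun i => 2 * (2 ^ b * (T ^ 2) ^ L) ^ 2 * r ^ (L - h (d - i)))
      (v := prodWeight W) ?_ ?_ hd ?_ ?_ ?_ ?_ ?_ ?_
    · rw [Nat.sub_zero, eL, hL, Nat.sub_self, pow_zero, mul_one]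
      simp only [upVal_true]
      exact prod
    · simp only [Fintype.card_prod, Fintype.card_bool, Fintype.card_fin]
      rw [sq]
    · exact fun i hi x y => M.upStep_upVal _ _ _ (levelSet_mono (hmono (by omega))) y
    · exact fun i hi y => M.rowSupport_upStep_le (hmono (by omega)) (hle _ (by omega)) y
    · intro i hi
      have h3 : h (d - (i + 1)) ≤ h (d - i) := hmono (by omega)
      have h4 : h (d - i) ≤ L := hle _ (by omega)
      rw [mul_left_comm, ← pow_add]
      congr 2
      omega
    · intro i hi
      refine lt_of_le_of_lt ?_ hlt
      exact Nat.mul_le_mul_left _ (Nat.pow_le_pow_right hr1 (Nat.sub_le _ _))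
    · intro i hi
      refine (M.matSupport_upStep_le (hmono (by omega)) (hle _ (by omega))).trans ?_
      have := hS (d - (i + 1)) (by omega)
      rwa [show d - (i + 1) + 1 = d - i by omega] at this
    · exact fun i hi => (hcard (d - (i + 1)) (by omega)).1
  -- The upward chain visits the levels in reverse order, so its last level is the one with index d
  -- - d.
  rw [Nat.sub_self, e0] at up
  obtain ⟨C, hCd, hCs, hC⟩ := up
  refine ⟨C.comp (wires fun k => (entryIndex r k.1 k.2.1, k.2.2.1, k.2.2.2)), ?_, ?_, ?_⟩
  · intro x y
    ext i j
    refine Eq.trans ?_ (((hC (Sum.elim x y)).eq (entryIndex r i j)).trans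
      (M.upVal_downVal x y i j))
    rw [cast_partValue_binWeight, cast_partValue_binWeight, comp_eval]
    rfl
  · refine (comp_depth_le _ _).trans ?_
    rw [wires_depth]
    omega
  · rw [comp_size, wires_size]
    refine hCs.trans ?_
    have hW1 : 1 ≤ W := by omega
    have hWW : W ≤ W ^ 3 := Nat.le_self_pow (by norm_num) W
    have hWW' : W ^ 2 ≤ W ^ 3 := Nat.pow_le_pow_right hW1 (by norm_num)
    -- The constant is 34 = 20 + 4 + 10: down for both factors, the products, up.
    calc _ ≤ 0 + d * ((8 * W ^ 3 + 2 * W ^ 3) * (2 * S)) + 4 * W ^ 3 * (d * S) +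
          d * ((8 * W ^ 3 + 2 * W ^ 3) * S) := by
          gcongr
          exact cardL.trans (Nat.le_mul_of_pos_left _ hd)
      _ = 34 * W ^ 3 * (d * S) := by ring

end MatMulAlgorithm

/-! ### Exponents and the choice of levels -/

namespace MatMulAlgorithm

variable {T r : ℕ} (M : MatMulAlgorithm T r)

/-- Every multiplication uses at least one entry of A. This is what gives α ≤ 1 and thus γ ≥ 0. -/
theorem le_sparsity : r ≤ M.sparsity := by
  refine le_trans ?_ (le_max_left _ _)
  calc r = ∑ _l : Fin r, 1 := by simp
    _ ≤ _ := Finset.sum_le_sum fun l _ => by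
      obtain ⟨p, q, hpq⟩ := M.a_nonempty l
      exact Finset.card_pos.2 ⟨(p, q), by simpa using hpq⟩

theorem sq_lt_sparsity (hr : T ^ 2 < r) : (T : ℝ) ^ 2 < M.sparsity := by
  exact_mod_cast hr.trans_le M.le_sparsity

variable (hT : 2 ≤ T) (hr : T ^ 2 < r)
include hT hr

theorem one_lt_beta : 1 < M.beta := by
  have h : (0 : ℝ) < (T : ℝ) ^ 2 := by positivity
  rw [beta, one_lt_div h]
  exact M.sq_lt_sparsity hr

omit hT in
theorem sparsity_pos : (0 : ℝ) < M.sparsity :=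
  (sq_nonneg (T : ℝ)).trans_lt (M.sq_lt_sparsity hr)

omit hT in
theorem alpha_pos : 0 < M.alpha :=
  div_pos (by exact_mod_cast (Nat.zero_le _).trans_lt hr) (M.sparsity_pos hr)

omit hT in
theorem alpha_le_one : M.alpha ≤ 1 := by
  rw [alpha, div_le_one (M.sparsity_pos hr)]
  exact_mod_cast M.le_sparsity

theorem alpha_mul_beta : M.alpha * M.beta * (T : ℝ) ^ 2 = r := by
  have h1 := (M.sparsity_pos hr).ne'
  have h2 : (T : ℝ) ^ 2 ≠ 0 := by positivity
  rw [alpha, beta]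
  field_simp

theorem one_lt_alpha_mul_beta : 1 < M.alpha * M.beta := by
  have h : (0 : ℝ) < (T : ℝ) ^ 2 := by positivity
  have h1 := M.alpha_mul_beta hT hr
  have h2 : (T : ℝ) ^ 2 < r := by exact_mod_cast hr
  nlinarith

theorem gamma_nonneg : 0 ≤ M.gamma := by
  refine Real.logb_nonneg (M.one_lt_beta hT hr) ?_
  exact (one_le_div (M.alpha_pos hr)).2 (M.alpha_le_one hr)

theorem gamma_lt_one : M.gamma < 1 := by
  have hα := M.alpha_pos hr
  rw [gamma, Real.logb_lt_iff_lt_rpow (M.one_lt_beta hT hr) (by positivity), Real.rpow_one,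
    div_lt_iff₀ hα, mul_comm]
  exact M.one_lt_alpha_mul_beta hT hr

theorem alpha_eq : M.alpha = M.beta ^ (-M.gamma) := by
  have hβ := M.one_lt_beta hT hr
  have hα := M.alpha_pos hr
  rw [Real.rpow_neg (by linarith), gamma, Real.rpow_logb (by linarith) hβ.ne' (by positivity),
    one_div, inv_inv]

/-- Since α = β^(-γ), the product αβ equals β^(1-γ), and the denominator of c cancels. -/
theorem cConst_eq : M.cConst = Real.logb T M.beta := by
  have hβ := M.one_lt_beta hT hr
  have hγ := M.gamma_lt_one hT hr
  have h : M.alpha * M.beta = M.beta ^ (1 - M.gamma) := by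
    rw [sub_eq_add_neg, Real.rpow_add (by linarith), Real.rpow_one, ← M.alpha_eq hT hr, mul_comm]
  rw [cConst, h, Real.logb_rpow_eq_mul_logb_of_pos (by linarith),
    mul_div_cancel_left₀ _ (by linarith)]

theorem cConst_pos : 0 < M.cConst := by
  rw [M.cConst_eq hT hr]
  exact Real.logb_pos (by exact_mod_cast hT) (M.one_lt_beta hT hr)

omit hr in
theorem rpow_logb_mul_pow {x : ℝ} (hx : 0 < x) (L : ℕ) (y : ℝ) :
    (((T ^ L : ℕ) : ℝ)) ^ (Real.logb T x * y) = x ^ ((L : ℝ) * y) := by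
  have h2 : (2 : ℝ) ≤ T := by exact_mod_cast hT
  have hT0 : (0 : ℝ) < T := by linarith
  rw [Nat.cast_pow, ← Real.rpow_natCast, ← Real.rpow_mul hT0.le, mul_left_comm,
    Real.rpow_mul hT0.le, Real.rpow_logb hT0 (by linarith) hx]

/-- The levels of the recursion tree at which the circuit computes all matrices. -/
noncomputable def level (M : MatMulAlgorithm T r) (L d i : ℕ) : ℕ :=
  ⌈(L : ℝ) * (1 - M.gamma ^ i) / (1 - M.gamma ^ d)⌉₊

omit hT hr in
theorem level_zero (L d : ℕ) : M.level L d 0 = 0 := by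
  simp [level]

theorem gamma_pow_lt_one {d : ℕ} (hd : 1 ≤ d) : M.gamma ^ d < 1 :=
  pow_lt_one₀ (M.gamma_nonneg hT hr) (M.gamma_lt_one hT hr) (by omega)

theorem level_self (L : ℕ) {d : ℕ} (hd : 1 ≤ d) : M.level L d d = L := by
  have h := M.gamma_pow_lt_one hT hr hd
  rw [level, mul_div_cancel_right₀ _ (by linarith), Nat.ceil_natCast]

theorem level_monotone (L : ℕ) {d : ℕ} (hd : 1 ≤ d) : Monotone (M.level L d) := by
  intro i j hij
  have h := M.gamma_pow_lt_one hT hr hd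
  have h2 : M.gamma ^ j ≤ M.gamma ^ i :=
    pow_le_pow_of_le_one (M.gamma_nonneg hT hr) (M.gamma_lt_one hT hr).le hij
  refine Nat.ceil_mono (div_le_div_of_nonneg_right ?_ (by linarith))
  exact mul_le_mul_of_nonneg_left (by linarith) (Nat.cast_nonneg L)

/-- Without rounding the left side equals L(1-γ)/(1-γ^d) for every i, so all steps are balanced.
Rounding up adds at most 1, because it can only increase the subtracted term. -/
theorem level_succ_le (L : ℕ) {d : ℕ} (hd : 1 ≤ d) (i : ℕ) :
    (M.level L d (i + 1) : ℝ) - M.gamma * M.level L d i ≤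
      (L : ℝ) * (1 - M.gamma) + L * M.gamma ^ d + 1 := by
  have hγ := M.gamma_nonneg hT hr
  have hγ1 := M.gamma_lt_one hT hr
  have hd1 := M.gamma_pow_lt_one hT hr hd
  have hdγ : M.gamma ^ d ≤ M.gamma := pow_le_of_le_one hγ hγ1.le (by omega)
  have hi1 : M.gamma ^ (i + 1) ≤ 1 := pow_le_one₀ hγ hγ1.le
  have h1 : (M.level L d (i + 1) : ℝ) ≤
      (L : ℝ) * (1 - M.gamma ^ (i + 1)) / (1 - M.gamma ^ d) + 1 := by
    refine (Nat.ceil_lt_add_one ?_).le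
    exact div_nonneg (mul_nonneg (Nat.cast_nonneg _) (by linarith)) (by linarith)
  have h2 : (L : ℝ) * (1 - M.gamma ^ i) / (1 - M.gamma ^ d) ≤ M.level L d i := Nat.le_ceil _
  have h3 := mul_le_mul_of_nonneg_left h2 hγ
  have h4 : (L : ℝ) * (1 - M.gamma ^ (i + 1)) / (1 - M.gamma ^ d) -
      M.gamma * ((L : ℝ) * (1 - M.gamma ^ i) / (1 - M.gamma ^ d)) =
      (L : ℝ) * (1 - M.gamma) / (1 - M.gamma ^ d) := by
    rw [pow_succ]
    ring
  -- After clearing the denominator, the difference of the two sides is Lγ^d(γ-γ^d), nonnegative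
  -- since d ≥ 1.
  have h5 : (L : ℝ) * (1 - M.gamma) / (1 - M.gamma ^ d) ≤
      (L : ℝ) * (1 - M.gamma) + L * M.gamma ^ d := by
    rw [div_le_iff₀ (by linarith)]
    have h6 : 0 ≤ (L : ℝ) * M.gamma ^ d * (M.gamma - M.gamma ^ d) :=
      mul_nonneg (mul_nonneg (Nat.cast_nonneg _) (pow_nonneg hγ _)) (by linarith)
    linarith
  linarith

/-- The number of terms in one step of the circuit. -/
theorem step_cost_le (L : ℕ) {d : ℕ} (hd : 1 ≤ d) {i : ℕ} (hi : i < d) :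
    ((r ^ M.level L d i * M.sparsity ^ (M.level L d (i + 1) - M.level L d i) *
      (T ^ 2) ^ (L - M.level L d (i + 1)) : ℕ) : ℝ) ≤
      M.beta * ((T ^ L : ℕ) : ℝ) ^ (M.omega + M.cConst * M.gamma ^ d) := by
  have hβ := M.one_lt_beta hT hr
  have hβ0 : 0 < M.beta := by linarith
  have hT0 : (0 : ℝ) < T := by exact_mod_cast (by omega : 0 < T)
  have hr0 : (0 : ℝ) < r := by exact_mod_cast (Nat.zero_le _).trans_lt hr
  have hle := M.level_succ_le hT hr L hd i
  have hm1 := M.level_monotone hT hr L hd i.le_succ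
  have hm2 := M.level_monotone hT hr L hd (Nat.succ_le_of_lt hi)
  rw [M.level_self hT hr L hd] at hm2
  have hαβ := M.alpha_mul_beta hT hr
  have hα := M.alpha_eq hT hr
  have hs : (M.sparsity : ℝ) = M.beta * (T : ℝ) ^ 2 := by
    rw [beta, div_mul_cancel₀ _ (by positivity)]
  change M.level L d (i + 1) ≤ L at hm2
  change M.level L d i ≤ M.level L d (i + 1) at hm1
  generalize M.level L d (i + 1) = h' at *
  generalize M.level L d i = h at *
  -- Substitute r = αβT^2 and s = βT^2.
  have e1 : ((r ^ h * M.sparsity ^ (h' - h) * (T ^ 2) ^ (L - h') : ℕ) : ℝ) =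
      M.alpha ^ h * M.beta ^ h' * ((T : ℝ) ^ 2) ^ L := by
    obtain ⟨m, rfl⟩ := Nat.exists_eq_add_of_le hm1
    obtain ⟨n, rfl⟩ := Nat.exists_eq_add_of_le hm2
    rw [Nat.add_sub_cancel_left, Nat.add_sub_cancel_left]
    push_cast
    rw [← hαβ, hs]
    ring
  have e2 : M.alpha ^ h * M.beta ^ h' = M.beta ^ ((h' : ℝ) - M.gamma * h) := by
    rw [hα, ← Real.rpow_natCast, ← Real.rpow_natCast, ← Real.rpow_mul hβ0.le,
      ← Real.rpow_add hβ0]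
    congr 1
    ring
  -- Here N^ω = r^L = (αβ)^L T^(2L) with αβ = β^(1-γ), while N^c = β^L.
  have e3 : ((T ^ L : ℕ) : ℝ) ^ (M.omega + M.cConst * M.gamma ^ d) =
      M.beta ^ ((L : ℝ) * (1 - M.gamma) + L * M.gamma ^ d) * ((T : ℝ) ^ 2) ^ L := by
    have hN : (0 : ℝ) < ((T ^ L : ℕ) : ℝ) := by
      rw [Nat.cast_pow]; positivity
    have h1 := rpow_logb_mul_pow hT hr0 L 1
    rw [mul_one, mul_one, Real.rpow_natCast, ← hαβ, mul_pow] at h1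
    have h2 : M.beta ^ ((L : ℝ) * (1 - M.gamma)) = (M.alpha * M.beta) ^ L := by
      rw [mul_comm, Real.rpow_mul hβ0.le, Real.rpow_natCast, sub_eq_add_neg,
        Real.rpow_add hβ0, Real.rpow_one, ← hα, mul_comm M.beta]
    rw [Real.rpow_add hN, Real.rpow_add hβ0, M.cConst_eq hT hr, rpow_logb_mul_pow hT hβ0, h2,
      omega, ← hαβ, h1]
    ring
  rw [e1, e2, e3, ← mul_assoc]
  refine mul_le_mul_of_nonneg_right ?_ (by positivity)
  refine (Real.rpow_le_rpow_of_exponent_le hβ.le hle).trans (le_of_eq ?_)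
  rw [Real.rpow_add hβ0 _ 1, Real.rpow_one, mul_comm]

omit hr in
-- L = log N / log T, and L ≥ 1 absorbs the additive constant 2.
theorem width_le {κ : ℝ} {L b : ℕ} (hL : 1 ≤ L)
    (hb : (b : ℝ) ≤ κ * Real.log ((T ^ L : ℕ) : ℝ)) :
    (width T r L b : ℝ) ≤
      (2 * κ + (2 + (T : ℝ) ^ 4 * r) / Real.log T) * Real.log ((T ^ L : ℕ) : ℝ) := by
  have hlog : 0 < Real.log T := Real.log_pos (by exact_mod_cast hT)
  have e : Real.log ((T ^ L : ℕ) : ℝ) = L * Real.log T := by rw [Nat.cast_pow, Real.log_pow]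
  have h1 : (1 : ℝ) ≤ L := by exact_mod_cast hL
  have h2 : (2 + (T : ℝ) ^ 4 * r) / Real.log T * (L * Real.log T) = (2 + (T : ℝ) ^ 4 * r) * L := by
    field_simp
  rw [add_mul, mul_assoc 2 κ, e, h2, ← e, width]
  push_cast at hb ⊢
  linarith

end MatMulAlgorithm

theorem mainTheorem1 {T r : ℕ} (hT : 2 ≤ T) (hr : T ^ 2 < r) (M : MatMulAlgorithm T r) :
    0 < M.cConst ∧ 0 ≤ M.gamma ∧ M.gamma < 1 ∧
    ∀ κ : ℝ, ∃ (K : ℝ) (e : ℕ), ∀ l b d N : ℕ, 1 ≤ l → N = T ^ l → 1 ≤ d →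
      (b : ℝ) ≤ κ * Real.log N →
      ∃ (m : ℕ) (C : ThresholdCircuit (MatrixBits N b ⊕ MatrixBits N b) (MatrixBits N m)),
        C.ComputesMatMul ∧
        C.depth ≤ 4 * d + 1 ∧
        (C.size : ℝ) ≤
          K * Real.log N ^ e * (d * (N : ℝ) ^ (M.omega + M.cConst * M.gamma ^ d)) := by
  refine ⟨M.cConst_pos hT hr, M.gamma_nonneg hT hr, M.gamma_lt_one hT hr, fun κ =>
    -- The cube of the bit width is O((log N)^3); the factor β is the price of rounding the levels.
    ⟨34 * (2 * κ + (2 + (T : ℝ) ^ 4 * r) / Real.log T) ^ 3 * M.beta, 3, ?_⟩⟩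
  rintro l b d _ hl rfl hd hb
  have hβ : 0 ≤ M.beta := zero_le_one.trans (M.one_lt_beta hT hr).le
  have hx : 0 ≤ M.beta * ((T ^ l : ℕ) : ℝ) ^ (M.omega + M.cConst * M.gamma ^ d) := by positivity
  obtain ⟨C, hC, hdepth, hsize⟩ := M.exists_circuit (L := l) (b := b) (d := d)
    (S := ⌊M.beta * ((T ^ l : ℕ) : ℝ) ^ (M.omega + M.cConst * M.gamma ^ d)⌋₊)
    (h := M.level l d) (by omega) hr.le M.le_sparsity hd (M.level_monotone hT hr l hd)
    (M.level_zero l d) (M.level_self hT hr l hd)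
    (fun i hi => Nat.le_floor (M.step_cost_le hT hr l hd hi))
  refine ⟨_, C, hC, hdepth, ?_⟩
  have hW := MatMulAlgorithm.width_le (r := r) hT hl hb
  calc (C.size : ℝ) ≤ ((34 * MatMulAlgorithm.width T r l b ^ 3 *
        (d * ⌊M.beta * ((T ^ l : ℕ) : ℝ) ^ (M.omega + M.cConst * M.gamma ^ d)⌋₊) : ℕ) : ℝ) := by
        exact_mod_cast hsize
    _ = 34 * (MatMulAlgorithm.width T r l b : ℝ) ^ 3 *
        (d * (⌊M.beta * ((T ^ l : ℕ) : ℝ) ^ (M.omega + M.cConst * M.gamma ^ d)⌋₊ : ℝ)) := by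
        push_cast; ring
    _ ≤ 34 * ((2 * κ + (2 + (T : ℝ) ^ 4 * r) / Real.log T) *
          Real.log ((T ^ l : ℕ) : ℝ)) ^ 3 *
        (d * (M.beta * ((T ^ l : ℕ) : ℝ) ^ (M.omega + M.cConst * M.gamma ^ d))) := by
        gcongr
        · exact mul_nonneg (by norm_num) (pow_nonneg ((Nat.cast_nonneg _).trans hW) 3)
        · exact Nat.floor_le hx
    _ = _ := by ring
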